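/- **Conventions.** Let $L$ be a finite non-empty (upper) semimodular lattice, $J(L)$ the set of its non-zero join-irreducible elements. For a finite poset $P$ with least element $0$ write $A(P)$ for the set of atoms (elements covering $0$), $A(x)=\{a\in A(P):a\le x\}$, $\ell(P)$ for the length (largest $n$ such that $P$ has an $(n+1)$-element chain), $\ell_P(x)=\ell([0,x])$, and $\varphi_P(i)=\{x\in P:\ell_P(x)=i\}$. Define $\mathfrak I_P(x)=\{\emptyset\}$ if $\ell_P(x)=0$ and otherwise $\mathfrak I_P(x)=\{S\cup\{a\}: S\in\mathfrak I_P(y),\ a\in A(x)-A(y),\ y\prec x,\ \ell_P(x)=\ell_P(y)+1\}$; let $\phi_P(i)=\bigcup\{\mathfrak I_P(x):x\in\varphi_P(i)\}$. A finite lattice is *geometric* if it is semimodular and each element is a join of atoms. $L\hookrightarrow^{\prec}G$ means that there is an injective lattice homomorphism $L\to G$ that preserves the covering relation. A *best extending cover-preserving geometric lattice* of $L$ is a finite geometric lattice $G$ with $L\hookrightarrow^{\prec}G$ that has the smallest number of elements among all such lattices. **Extending standard forms.** Let $H(L)=L-(A(L)\cup\{0\})$. An extending standard form $P$ of $L$ is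 obtained by choosing pairwise disjoint finite sets $\Delta(x)$, $x\in H(L)$, disjoint from $L$, with $\Delta(x)\ne\emptyset$ for all $x\in J(L)\cap H(L)$, and inserting them into $L$ so that $0\prec x'\prec x$ for $x'\in\Delta(x)$ (so $x'\le y\iff x\le y$ for $y\in L$). Put $\mathcal S_P=\{A(x):x\in P\}$, ordered by inclusion. **Algorithm 1.** All families of sets below are ordered by inclusion. For a family $\mathcal O$ and a set $X$, $\overline{X_{\mathcal O}}$ is the join in $\mathcal O$ of the atoms $T$ of $\mathcal O$ with $T\subseteq X$. Let $m=\ell(L)$. Start with $\mathcal R=\mathcal S_P$, $k=3$. All choices are arbitrary. * Step 1. $\mathcal Q:=\mathcal R$, $t:=k$. If some $X\in\varphi_{\mathcal Q}(k)$ has a proper subset $U$ such that (i1) $\overline{Y_{\mathcal R}}\subseteq U$ whenever $V\in\varphi_{\mathcal Q}(t-1)$ and $Y\subseteq U\cap V$; (i2) $\bigcup\sigma\not\subseteq U$ for all $\sigma\in\phi_{\mathcal Q}(k-1)$; (i3) $U\not\subseteq V$ for all $V\in\varphi_{\mathcal Q}(k-1)$; then choose such a $U$, put $\mathcal Q:=\mathcal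 Q\cup\{U\}$ and go to Step 2. Otherwise $k:=k+1$; if $k\ge m+1$, stop with output $\mathcal Q$; if not, repeat Step 1. * Step 2. If $\ell_{\mathcal Q}(U)=k-1$, put $k:=3$, $\mathcal R:=\mathcal Q$ and go to Step 1; otherwise go to Step 3. * Step 3. If $U$ has a proper subset $W$ such that (j1) $\overline{Y_{\mathcal R}}\subseteq W$ whenever $V\in\varphi_{\mathcal Q}(t-1)$ and $Y\subseteq W\cap V$; (j2) $\bigcup\sigma\not\subseteq W$ for all $\sigma\in\phi_{\mathcal Q}(k-2)$; (j3) $W\not\subseteq V$ for all $V\in\varphi_{\mathcal Q}(k-2)$; then choose such a $W$, put $\mathcal Q:=\mathcal Q\cup\{W\}$ and go to Step 4. Otherwise go to Step 1. * Step 4. If $\ell_{\mathcal Q}(W)=k-2$, put $k:=3$, $\mathcal R:=\mathcal Q$ and go to Step 1. Otherwise put $k:=k-1$, $U:=W$ and go to Step 3. Let $\overline{\mathfrak S}_n$ be the class of all outputs $\mathcal Q$ of terminating runs of Algorithm 1, over all extending standard forms $P$ of $L$, that have exactly $n$ atoms and satisfy the condition $(\mathfrak M)$: if $X\in\varphi_{\mathcal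 Q}(k)$, then $\ell_{\mathcal Q}(\overline{(X\cup R)_{\mathcal Q}})=k+1$ for every $R\in A(\mathcal Q)-A(X)$. **Theorem.** Let $L$ be a finite non-empty semimodular lattice and let $G$ be a best extending cover-preserving geometric lattice of $L$. Then $G$ is isomorphic to some $\mathcal Q\in\overline{\mathfrak S}_{|J(L)|}$ that has the smallest number of elements among all members of $\overline{\mathfrak S}_{|J(L)|}$. In particular $G$ is, up to isomorphism, produced by Algorithm 1, and $\ell(G)=\ell(L)$ and $|A(G)|=|J(L)|$. -/

import Mathlib

universe u v

/-! ### Posets: atoms, levels, independent function, geometric lattices -/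

/-- `A(P)`: the elements that cover the least element. -/
def atomSet (P : Type u) [PartialOrder P] : Set P :=
  {a | ∃ b : P, IsBot b ∧ b ⋖ a}

/-- `A(x)`: the atoms below `x`. -/
def atomsBelow {P : Type u} [PartialOrder P] (x : P) : Set P :=
  {a | a ∈ atomSet P ∧ a ≤ x}

/-- `φ_P(i)` (written with a varphi): the elements `x` with `ℓ(x) = i`, where `ℓ(x)` is the length
of `[0, x]`, that is, the supremum of the lengths of the chains that end in `x`. -/
def level (P : Type u) [PartialOrder P] (i : ℕ) : Set P :=
  {x | Order.height x = (i : ℕ∞)}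

/-- `MemIndep x S` says that `S` belongs to `𝔍_P(x)`, the value at `x` of the independent function
of `P`: it is `{∅}` if `ℓ(x) = 0`, and for `ℓ(x) ≥ 1` it consists of the sets `S ∪ {a}` with
`S ∈ 𝔍_P(y)`, `a ∈ A(x) - A(y)`, `ℓ(x) = ℓ(y) + 1` and `y` covered by `x`. -/
inductive MemIndep {P : Type u} [PartialOrder P] : P → Set P → Prop
  | zero (x : P) (hx : Order.height x = 0) : MemIndep x ∅
  | succ (x y : P) (S : Set P) (a : P) (hS : MemIndep y S)
      (ha : a ∈ atomsBelow x \ atomsBelow y)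
      (hl : Order.height x = Order.height y + 1) (hyx : y ⋖ x) : MemIndep x (insert a S)

/-- `φ_P(i)` (written with a phi): all members of `𝔍_P(x)` for the elements `x` with `ℓ(x) = i`. -/
def indepLevel (P : Type u) [PartialOrder P] (i : ℕ) : Set (Set P) :=
  {σ | ∃ x ∈ level P i, MemIndep x σ}

/-- A finite geometric lattice: semimodular, and every element is a join of atoms. -/
def IsFiniteGeometric (G : Type u) [Lattice G] : Prop :=
  Finite G ∧ IsUpperModularLattice G ∧ ∀ x : G, ∃ s ⊆ atomSet G, IsLUB s x

/-- `L` is (up to isomorphism) a cover-preserving sublattice of `G`. -/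
def CoverPreservingEmbeds (L : Type u) (G : Type v) [Lattice L] [Lattice G] : Prop :=
  ∃ f : LatticeHom L G, Function.Injective f ∧ ∀ a b : L, a ⋖ b → f a ⋖ f b

/-- `G` is a best extending cover-preserving geometric lattice of `L`: it has the smallest number
of elements among all finite geometric lattices that contain `L` as a cover-preserving
sublattice. -/
def IsBestExtension (L : Type u) (G : Type v) [Lattice L] [Lattice G] : Prop :=
  (IsFiniteGeometric G ∧ CoverPreservingEmbeds L G) ∧
    ∀ (G' : Type v) [Lattice G'], IsFiniteGeometric G' → CoverPreservingEmbeds L G' →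
      Nat.card G ≤ Nat.card G'

/-! ### Extending standard forms -/

/-- `J(L)`: the non-zero join-irreducible elements. -/
def joinIrr (L : Type u) [Lattice L] : Set L := {x | SupIrred x}

/-- `H(L) = L - (A(L) ∪ {0})`. -/
def nonAtoms (L : Type u) [Lattice L] : Set L := {x | x ∉ atomSet L ∧ ¬ IsBot x}

/-- The data of a finite extending standard form of `L`: the finite set `D` of inserted elements,
the disjoint union of the sets `Δ(x) = {d | base d = x}` with `x ∈ H(L)`, where `Δ(x)` is non-empty
for every `x ∈ J(L) ∩ H(L)`. -/
structure StandardForm (L : Type u) [Lattice L] where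
  D : Type
  finite_D : Finite D
  base : D → L
  base_mem : ∀ d, base d ∈ nonAtoms L
  exists_base : ∀ x ∈ joinIrr L ∩ nonAtoms L, ∃ d, base d = x

/-- The underlying set `L ∪ ⋃ Δ(x)` of an extending standard form. -/
inductive StandardForm.Carrier {L : Type u} [Lattice L] (E : StandardForm L) : Type u
  | old (x : L) : StandardForm.Carrier E
  | new (d : E.D) : StandardForm.Carrier E

/-- The order of an extending standard form: it extends the order of `L`, and each inserted element
`d` satisfies `0 ≺ d ≺ base d`. -/
def StandardForm.Carrier.le {L : Type u} [Lattice L] {E : StandardForm L} :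
    E.Carrier → E.Carrier → Prop
  | .old x, .old y => x ≤ y
  | .old x, .new _ => IsBot x
  | .new d, .old y => E.base d ≤ y
  | .new d, .new e => d = e

instance StandardForm.instPartialOrder {L : Type u} [Lattice L] (E : StandardForm L) :
    PartialOrder E.Carrier where
  le := StandardForm.Carrier.le
  le_refl a := by cases a <;> simp [StandardForm.Carrier.le]
  le_trans a b c hab hbc := by
    cases a <;> cases b <;> cases c <;> simp only [StandardForm.Carrier.le] at *
    · exact hab.trans hbc
    · exact fun z => hab.trans (hbc z)
    · exact hab _
    · exact hab
    · exact hab.trans hbc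
    · exact absurd (fun z => hab.trans (hbc z)) (E.base_mem _).2
    · exact hab ▸ hbc
    · exact hab.trans hbc
  le_antisymm a b hab hba := by
    cases a <;> cases b <;> simp only [StandardForm.Carrier.le] at *
    · exact congrArg _ (le_antisymm hab hba)
    · exact absurd (fun z => hba.trans (hab z)) (E.base_mem _).2
    · exact absurd (fun z => hab.trans (hba z)) (E.base_mem _).2
    · exact congrArg _ hab

/-- `𝒮_P = {A(x) : x ∈ P}`. -/
def atomFamily (P : Type u) [PartialOrder P] : Set (Set P) := Set.range (atomsBelow (P := P))

/-! ### The algorithm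

A family `𝒬 : Set (Set α)` is regarded as the poset `↥𝒬`, ordered by inclusion. -/

/-- `C` is the join in `𝒪` of the atoms `T` of `𝒪` with `T ⊆ X`. -/
def IsFamilyClosure {α : Type u} (O : Set (Set α)) (X : Set α) (C : O) : Prop :=
  IsLUB {T : O | T ∈ atomSet O ∧ (T : Set α) ⊆ X} C

/-- The three conditions on a candidate set `U`; `(i1)`-`(i3)` are the case `𝒬 = ℛ`, `i = k - 1`
and `(j1)`-`(j3)` the case `i = k - 2`. -/
structure Admissible {α : Type u} (Q R : Set (Set α)) (t i : ℕ) (U : Set α) : Prop where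
  closed : ∀ V ∈ level Q (t - 1), ∀ Y : Set α, Y ⊆ U ∩ (V : Set α) →
    ∃ C : R, IsFamilyClosure R Y C ∧ (C : Set α) ⊆ U
  not_indep : ∀ σ ∈ indepLevel Q i, ¬ (⋃ T ∈ σ, (T : Set α)) ⊆ U
  not_below : ∀ V ∈ level Q i, ¬ U ⊆ (V : Set α)

/-- `X` is a member of the family `𝒬` with `ℓ_𝒬(X) = i`. -/
def HasLength {α : Type u} (Q : Set (Set α)) (X : Set α) (i : ℕ) : Prop :=
  ∃ h : X ∈ Q, (⟨X, h⟩ : Q) ∈ level Q i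

/-- `U` can be chosen in Step 1 of the algorithm (where `𝒬 = ℛ` and `t = k`). -/
def StepOneChoice {α : Type u} (R : Set (Set α)) (k : ℕ) (U : Set α) : Prop :=
  (∃ X ∈ level R k, U ⊂ (X : Set α)) ∧ Admissible R R k (k - 1) U

/-- `W` can be chosen in Step 3 of the algorithm. -/
def StepThreeChoice {α : Type u} (Q R : Set (Set α)) (k t : ℕ) (U W : Set α) : Prop :=
  W ⊂ U ∧ Admissible Q R t (k - 2) W

/-- The states of the algorithm: the step to be executed next and the values of the variables that
it still reads. In `step3`, the set `U` is the set added to `𝒬` last. -/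
inductive AlgState (α : Type u) : Type u
  | step1 (R : Set (Set α)) (k : ℕ) : AlgState α
  | step2 (Q R : Set (Set α)) (k t : ℕ) (U : Set α) : AlgState α
  | step3 (Q R : Set (Set α)) (k t : ℕ) (U : Set α) : AlgState α
  | step4 (Q R : Set (Set α)) (k t : ℕ) (W : Set α) : AlgState α
  | stopped (Q : Set (Set α)) : AlgState α

/-- The (non-deterministic) transitions of the algorithm for a lattice of length `m`. -/
inductive AlgStep {α : Type u} (m : ℕ) : AlgState α → AlgState α → Prop
  | choose1 (R k U) (h : StepOneChoice R k U) :
      AlgStep m (.step1 R k) (.step2 (R ∪ {U}) R k k U)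
  | next1 (R k) (h : ∀ U, ¬ StepOneChoice R k U) (hk : ¬ m + 1 ≤ k + 1) :
      AlgStep m (.step1 R k) (.step1 R (k + 1))
  | stop1 (R k) (h : ∀ U, ¬ StepOneChoice R k U) (hk : m + 1 ≤ k + 1) :
      AlgStep m (.step1 R k) (.stopped R)
  | accept2 (Q R k t U) (h : HasLength Q U (k - 1)) :
      AlgStep m (.step2 Q R k t U) (.step1 Q 3)
  | continue2 (Q R k t U) (h : ¬ HasLength Q U (k - 1)) :
      AlgStep m (.step2 Q R k t U) (.step3 Q R k t U)
  | choose3 (Q R k t U W) (h : StepThreeChoice Q R k t U W) :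
      AlgStep m (.step3 Q R k t U) (.step4 (Q ∪ {W}) R k t W)
  | fail3 (Q R k t U) (h : ∀ W, ¬ StepThreeChoice Q R k t U W) :
      AlgStep m (.step3 Q R k t U) (.step1 R k)
  | accept4 (Q R k t W) (h : HasLength Q W (k - 2)) :
      AlgStep m (.step4 Q R k t W) (.step1 Q 3)
  | continue4 (Q R k t W) (h : ¬ HasLength Q W (k - 2)) :
      AlgStep m (.step4 Q R k t W) (.step3 Q R (k - 1) t W)

/-- `𝒬` is an output of the algorithm on the extending standard form `E` of `L`. -/
def IsAlgOutput {L : Type u} [Lattice L] (E : StandardForm L) (Q : Set (Set E.Carrier)) : Prop :=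
  ∃ m : ℕ, Order.krullDim L = (m : WithBot ℕ∞) ∧
    Relation.ReflTransGen (AlgStep m) (.step1 (atomFamily E.Carrier) 3) (.stopped Q)

/-- The condition `(𝔐)`: if `ℓ_𝒬(X) = k` and `T` is an atom of `𝒬` not below `X`, then the join in
`𝒬` of the atoms contained in `X ∪ T` has length `k + 1`. -/
def ConditionM {α : Type u} (Q : Set (Set α)) : Prop :=
  ∀ (k : ℕ), ∀ X ∈ level Q k, ∀ T ∈ atomSet Q \ atomsBelow X,
    ∃ C : Q, IsFamilyClosure Q ((X : Set α) ∪ (T : Set α)) C ∧ C ∈ level Q (k + 1)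

/-- Membership in the class of the outputs that satisfy `(𝔐)` and have exactly `n` atoms. -/
def MemOutputClass {L : Type u} [Lattice L] (n : ℕ) (E : StandardForm L)
    (Q : Set (Set E.Carrier)) : Prop :=
  IsAlgOutput E Q ∧ ConditionM Q ∧ (atomSet Q).ncard = n

universe w

/-! A family containing ∅ and the singletons of its ground set that satisfies `ConditionM` is the
family of flats of a simple matroid (`GeomFamily`), hence a geometric lattice. The proof bounds |G|
by the size of every such output and then realises G itself as one.

Every output in the class is an extension of L. Only a set of length exactly k - 1 is ever kept:
(i2) bounds the length of a candidate from above, (i3) makes a kept set harmless to the existing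
ranks, and Step 4 can never accept. So 𝒮_P keeps its ranks (`rankExtension_of_run`), and x ↦ A(x) is
an injective map of L into the output that preserves meets and ranks. Semimodularity of L turns it
into a cover-preserving lattice embedding (`coverPreservingEmbeds_of_rk`), and minimality of G gives
the bound (`IsBestExtension.card_le_of_memOutputClass`).

Conversely, let f embed L in G. For each j ∈ J(L) pick β j covering f ⊥, below f j but below no f y
with y < j. The sets {j : β j ≤ g}, g ∈ G, transferred to the atoms of `minimalForm`, form a
geometric family that extends L with the right ranks; by minimality the surjection from G onto it is
bijective (`IsBestExtension.exists_geomFamily`). Any geometric family 𝒬 that extends 𝒮_P with the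
same ranks is the output of some run (`GeomFamily.exists_run`): while ℛ ≠ 𝒬, take the least rank k
of an X ∈ ℛ above a missing member of 𝒬. Some missing hyperplane of X is a legal choice and is
accepted, and no smaller k offers any choice. -/

/-! ### Rank in a finite poset -/

/-- The height of an element as a natural number. -/
noncomputable def rk {P : Type u} [PartialOrder P] (x : P) : ℕ := (Order.height x).toNat

lemma height_eq_rk {P : Type u} [PartialOrder P] [Finite P] (x : P) :
    Order.height x = (rk x : ℕ∞) := by
  classical
  have := Fintype.ofFinite P
  refine (ENat.natCast_toNat ?_).symm
  refine ne_top_of_le_ne_top (ENat.natCast_ne_top (Fintype.card P)) ?_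
  refine Order.height_le fun p _ => ?_
  have h := Fintype.card_le_of_injective _ p.strictMono.injective
  simp only [Fintype.card_fin] at h
  exact_mod_cast (by omega : p.length ≤ Fintype.card P)

lemma mem_level_iff {P : Type u} [PartialOrder P] [Finite P] {x : P} {i : ℕ} :
    x ∈ level P i ↔ rk x = i := by
  simp only [level, Set.mem_ofPred_eq, height_eq_rk]
  exact Nat.cast_inj

lemma rk_lt_rk {P : Type u} [PartialOrder P] [Finite P] {x y : P} (h : x < y) : rk x < rk y := by
  have := Order.height_add_one_le h
  rw [height_eq_rk, height_eq_rk] at this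
  exact_mod_cast this

lemma rk_le_rk {P : Type u} [PartialOrder P] [Finite P] {x y : P} (h : x ≤ y) : rk x ≤ rk y := by
  rcases h.eq_or_lt with rfl | h
  · exact le_rfl
  · exact (rk_lt_rk h).le

lemma exists_lt_rk_eq {P : Type u} [PartialOrder P] [Finite P] {x : P} {n : ℕ} (h : n < rk x) :
    ∃ y < x, rk y = n := by
  have h' : (n : ℕ∞) < Order.height x := by rw [height_eq_rk]; exact_mod_cast h
  obtain ⟨y, hy, e⟩ := (Order.coe_lt_height_iff (by rw [height_eq_rk]; exact ENat.natCast_lt_top _)).1 h'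
  rw [height_eq_rk] at e
  exact ⟨y, hy, by exact_mod_cast e⟩

/-- The tool for all upper bounds on ranks: a strictly increasing function dominates the height. If
it failed at x, an element y < x of height ρ x would have ρ y ≥ ρ x. -/
lemma rk_le_of_strictMono_below {P : Type u} [PartialOrder P] [Finite P] (ρ : P → ℕ) (x : P)
    (h : ∀ a b, a < b → b ≤ x → ρ a < ρ b) : rk x ≤ ρ x := by
  induction x using (wellFounded_lt (α := P)).induction with
  | _ x ih =>
    by_contra! hlt
    obtain ⟨y, hy, e⟩ := exists_lt_rk_eq hlt
    have h1 := ih y hy fun a b hab hb => h a b hab (hb.trans hy.le)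
    have h2 := h y x hy le_rfl
    omega

lemma rk_eq_of_rank {P : Type u} [PartialOrder P] [Finite P] (ρ : P → ℕ)
    (hmono : ∀ a b, a < b → ρ a < ρ b) (hpred : ∀ x, ρ x ≠ 0 → ∃ y < x, ρ x = ρ y + 1) (x : P) :
    rk x = ρ x := by
  refine le_antisymm (rk_le_of_strictMono_below ρ x fun a b hab _ => hmono a b hab) ?_
  induction x using (wellFounded_lt (α := P)).induction with
  | _ x ih =>
    by_cases h0 : ρ x = 0
    · omega
    · obtain ⟨y, hy, e⟩ := hpred x h0
      have := ih y hy
      have := rk_lt_rk hy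
      omega

lemma covBy_of_rk {P : Type u} [PartialOrder P] [Finite P] {x y : P} (h : x < y)
    (e : rk y = rk x + 1) : x ⋖ y :=
  ⟨h, fun z hxz hzy => by have := rk_lt_rk hxz; have := rk_lt_rk hzy; omega⟩

lemma rk_isBot {P : Type u} [PartialOrder P] [Finite P] {x : P} (h : IsBot x) : rk x = 0 := by
  by_contra h0
  obtain ⟨y, hy, -⟩ := exists_lt_rk_eq (Nat.pos_of_ne_zero h0)
  exact absurd (h y) hy.not_ge

lemma isMin_of_rk_eq_zero {P : Type u} [PartialOrder P] [Finite P] {x : P} (h : rk x = 0) :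
    IsMin x := by
  intro y hy
  by_contra hlt
  have := rk_lt_rk (lt_of_le_not_ge hy hlt)
  omega

lemma exists_covBy_rk {P : Type u} [PartialOrder P] [Finite P] {x : P} (h : rk x ≠ 0) :
    ∃ y, y ⋖ x ∧ rk x = rk y + 1 := by
  obtain ⟨y, hy, e⟩ := exists_lt_rk_eq (x := x) (n := rk x - 1) (by omega)
  have e' : rk x = rk y + 1 := by omega
  exact ⟨y, covBy_of_rk hy e', e'⟩

/-! ### Finite semimodular lattices are graded -/

lemma covBy_sup_of_covBy_of_ne {P : Type u} [Lattice P] [IsUpperModularLattice P] {a b c : P} (hb : a ⋖ b) (hc : a ⋖ c) (hne : b ≠ c) :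
    b ⋖ b ⊔ c := by
  have hinf : b ⊓ c = a := by
    refine ((hb.eq_or_eq (le_inf hb.le hc.le) inf_le_left).resolve_right fun h => ?_)
    rcases hc.eq_or_eq hb.le (inf_eq_left.1 h) with h | h
    · exact hb.ne' h
    · exact hne h
  rw [sup_comm]
  exact IsUpperModularLattice.covBy_sup_of_inf_covBy (by rw [inf_comm, hinf]; exact hc)

section Graded

variable {P : Type u} [Lattice P] [Finite P] [IsUpperModularLattice P]

/-- The length of the longest chain from `a` to `y`. -/
noncomputable def corank (y : P) (a : Set.Iic y) : ℕ := rk (OrderDual.toDual a)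

/-- Jordan–Dedekind, by induction downwards from y. Let c be the cover of a on a longest chain. Both
b and c are covered by b ⊔ c, so by induction they have the same corank. -/
lemma corank_covBy (y : P) (a b : Set.Iic y) (h : (a : P) ⋖ b) :
    corank y a = corank y b + 1 := by
  induction a using (wellFounded_gt (α := Set.Iic y)).induction generalizing b with
  | _ a ih =>
    have hab : a < b := h.1
    have h1 : corank y b < corank y a :=
      rk_lt_rk (x := OrderDual.toDual b) (y := OrderDual.toDual a) hab
    obtain ⟨c, hc, e⟩ := exists_covBy_rk (x := OrderDual.toDual a) (by unfold corank at h1; omega)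
    obtain ⟨c, rfl⟩ := OrderDual.toDual.surjective c
    have hac : a < c := hc.1
    have hac' : (a : P) ⋖ c :=
      ⟨hac, fun z haz hzc => hc.2 (c := OrderDual.toDual ⟨z, hzc.le.trans c.2⟩) hzc haz⟩
    by_cases hbc : b = c
    · subst hbc; exact e
    have hne : (b : P) ≠ c := fun h => hbc (Subtype.ext h)
    have hb := covBy_sup_of_covBy_of_ne h hac' hne
    have hc' := covBy_sup_of_covBy_of_ne hac' h hne.symm
    rw [sup_comm] at hc'
    let d : Set.Iic y := ⟨b ⊔ c, sup_le b.2 c.2⟩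
    have e1 := ih b hab d hb
    have e2 := ih c hac d hc'
    have e3 : corank y a = corank y c + 1 := e
    omega

/-- Going down a longest chain below x, each step lowers the rank by one and raises the corank by
one. -/
lemma rk_add_corank [OrderBot P] (x y : P) (h : x ≤ y) :
    corank y ⟨⊥, bot_le⟩ = rk x + corank y ⟨x, h⟩ := by
  induction x using (wellFounded_lt (α := P)).induction with
  | _ x ih =>
    by_cases h0 : rk x = 0
    · have : x = ⊥ := le_bot_iff.1 (isMin_of_rk_eq_zero h0 bot_le)
      subst this
      omega
    · obtain ⟨z, hz, e⟩ := exists_covBy_rk h0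
      have e1 := ih z hz.lt (hz.le.trans h)
      have e2 := corank_covBy y ⟨z, hz.le.trans h⟩ ⟨x, h⟩ hz
      omega

lemma rk_covBy {x y : P} (h : x ⋖ y) : rk y = rk x + 1 := by
  have : Nonempty P := ⟨x⟩
  obtain ⟨b, -, hb⟩ := Finite.exists_le_minimal (p := fun _ : P => True) (a := x) trivial
  let _ : OrderBot P :=
    { bot := b
      bot_le := fun z => inf_eq_left.1 (le_antisymm inf_le_left (hb.2 trivial inf_le_left)) }
  have e1 := rk_add_corank x y h.le
  have e2 := rk_add_corank y y le_rfl
  have e3 := corank_covBy y ⟨x, h.le⟩ ⟨y, le_rfl⟩ h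
  omega

end Graded

/-! ### Families of subsets of a ground set -/

/-- `R` is a family of subsets of `A` that contains the empty set and the singletons. -/
structure BasicFamily {α : Type u} (A : Set α) (R : Set (Set α)) : Prop where
  sub : ∀ X ∈ R, X ⊆ A
  empty : ∅ ∈ R
  single : ∀ a ∈ A, {a} ∈ R

open Classical in
/-- The rank of `X` in the family `R`, and `0` if `X` is not a member of `R`. -/
noncomputable def famRk {α : Type u} (R : Set (Set α)) (X : Set α) : ℕ :=
  if h : X ∈ R then rk (⟨X, h⟩ : R) else 0

section Family

variable {α : Type u} {A : Set α} {R : Set (Set α)}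

lemma famRk_coe (X : R) : famRk R X = rk X := by
  simp [famRk]

lemma famRk_of_mem {X : Set α} (h : X ∈ R) : famRk R X = rk (⟨X, h⟩ : R) := famRk_coe ⟨X, h⟩

variable [Finite α]

lemma mem_level_family_iff {X : R} {i : ℕ} : X ∈ level R i ↔ famRk R X = i := by
  rw [mem_level_iff, famRk_coe]

lemma hasLength_iff {X : Set α} {i : ℕ} : HasLength R X i ↔ X ∈ R ∧ famRk R X = i := by
  constructor
  · rintro ⟨h, h'⟩
    exact ⟨h, mem_level_family_iff.1 h'⟩
  · rintro ⟨h, h'⟩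
    exact ⟨h, mem_level_family_iff.2 h'⟩

lemma famRk_lt {X Y : Set α} (hX : X ∈ R) (hY : Y ∈ R) (h : X ⊂ Y) :
    famRk R X < famRk R Y := by
  rw [famRk_of_mem hX, famRk_of_mem hY]
  exact rk_lt_rk h

lemma exists_ssubset_famRk_eq {X : Set α} (hX : X ∈ R) {n : ℕ} (h : n < famRk R X) :
    ∃ Y ∈ R, Y ⊂ X ∧ famRk R Y = n := by
  rw [famRk_of_mem hX] at h
  obtain ⟨Y, hY, e⟩ := exists_lt_rk_eq h
  exact ⟨Y, Y.2, hY, by rw [famRk_coe, e]⟩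

lemma famRk_le_of_strictMono_below (ρ : Set α → ℕ) {X : Set α} (hX : X ∈ R)
    (h : ∀ Y ∈ R, ∀ Z ∈ R, Y ⊂ Z → Z ⊆ X → ρ Y < ρ Z) : famRk R X ≤ ρ X := by
  rw [famRk_of_mem hX]
  exact rk_le_of_strictMono_below (fun Y : R => ρ Y) ⟨X, hX⟩
    fun a b hab hb => h a a.2 b b.2 hab hb

lemma famRk_eq_of_rank (ρ : Set α → ℕ) (hmono : ∀ Y ∈ R, ∀ Z ∈ R, Y ⊂ Z → ρ Y < ρ Z)
    (hpred : ∀ Z ∈ R, ρ Z ≠ 0 → ∃ Y ∈ R, Y ⊂ Z ∧ ρ Z = ρ Y + 1) {X : Set α} (hX : X ∈ R) :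
    famRk R X = ρ X := by
  rw [famRk_of_mem hX]
  refine rk_eq_of_rank (fun Y : R => ρ Y) (fun a b hab => hmono a a.2 b b.2 hab) ?_ ⟨X, hX⟩
  intro Z hZ
  obtain ⟨Y, hY, hYZ, e⟩ := hpred Z Z.2 hZ
  exact ⟨⟨Y, hY⟩, hYZ, e⟩

namespace BasicFamily

variable (hR : BasicFamily A R)
include hR

omit [Finite α] in
lemma isBot_iff (X : R) : IsBot X ↔ (X : Set α) = ∅ := by
  constructor
  · intro h
    exact Set.subset_empty_iff.1 (h ⟨∅, hR.empty⟩)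
  · intro h Y
    change (X : Set α) ⊆ Y
    rw [h]
    exact Set.empty_subset _

omit [Finite α] in
lemma mem_atomSet_iff (T : R) : T ∈ atomSet R ↔ ∃ a ∈ A, (T : Set α) = {a} := by
  constructor
  · rintro ⟨b, hb, hbT⟩
    rw [hR.isBot_iff] at hb
    have hne : (T : Set α) ≠ ∅ := fun h => hbT.ne (Subtype.ext (hb.trans h.symm))
    obtain ⟨a, ha⟩ := Set.nonempty_iff_ne_empty.2 hne
    have haA := hR.sub T T.2 ha
    refine ⟨a, haA, ?_⟩
    have h1 : b < (⟨{a}, hR.single a haA⟩ : R) := by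
      refine lt_of_le_of_ne ?_ ?_
      · change (b : Set α) ⊆ _
        rw [hb]
        exact Set.empty_subset _
      · intro h
        have := congrArg Subtype.val h
        rw [hb] at this
        exact Set.singleton_ne_empty a this.symm
    have h2 : (⟨{a}, hR.single a haA⟩ : R) ≤ T := Set.singleton_subset_iff.2 ha
    rcases h2.eq_or_lt with h | h
    · exact (congrArg Subtype.val h).symm
    · exact absurd h (hbT.2 h1)
  · rintro ⟨a, ha, hT⟩
    refine ⟨⟨∅, hR.empty⟩, (hR.isBot_iff _).2 rfl, ?_, ?_⟩
    · change (∅ : Set α) ⊂ T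
      rw [hT]
      exact Set.ssubset_iff_subset_ne.2 ⟨Set.empty_subset _, (Set.singleton_ne_empty a).symm⟩
    · intro Z hZ hZT
      have hZ' : (∅ : Set α) ⊂ Z := hZ
      have hZT' : (Z : Set α) ⊂ {a} := by rw [← hT]; exact hZT
      rw [Set.ssubset_singleton_iff] at hZT'
      rw [hZT'] at hZ'
      exact hZ'.ne rfl

-- The atoms are the singletons, so the join of the atoms inside Y is the least member that contains
-- Y.
omit [Finite α] in
lemma isFamilyClosure_iff {Y : Set α} (hY : Y ⊆ A) (C : R) :
    IsFamilyClosure R Y C ↔ Y ⊆ (C : Set α) ∧ ∀ Z ∈ R, Y ⊆ Z → (C : Set α) ⊆ Z := by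
  have key : ∀ Z : R, Z ∈ upperBounds {T : R | T ∈ atomSet R ∧ (T : Set α) ⊆ Y} ↔
      Y ⊆ (Z : Set α) := by
    intro Z
    constructor
    · intro h y hy
      have := h (a := ⟨{y}, hR.single y (hY hy)⟩)
        ⟨(hR.mem_atomSet_iff _).2 ⟨y, hY hy, rfl⟩, Set.singleton_subset_iff.2 hy⟩
      exact Set.singleton_subset_iff.1 this
    · rintro h T ⟨-, hT⟩
      exact hT.trans h
  constructor
  · rintro ⟨h1, h2⟩
    exact ⟨(key C).1 h1, fun Z hZ hYZ => h2 ((key ⟨Z, hZ⟩).2 hYZ)⟩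
  · rintro ⟨h1, h2⟩
    exact ⟨(key C).2 h1, fun Z hZ => h2 Z Z.2 ((key Z).1 hZ)⟩

lemma memIndep_insert {X Y : Set α} (hX : X ∈ R) (hY : Y ∈ R) (hYX : Y ⊂ X)
    (e : famRk R X = famRk R Y + 1) {p : α} (hpX : p ∈ X) (hpY : p ∉ Y) {σ : Set R}
    (hσ : MemIndep (⟨Y, hY⟩ : R) σ) :
    MemIndep (⟨X, hX⟩ : R) (insert ⟨{p}, hR.single p (hR.sub X hX hpX)⟩ σ) := by
  have hp := hR.sub X hX hpX
  rw [famRk_of_mem hX, famRk_of_mem hY] at e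
  refine MemIndep.succ _ ⟨Y, hY⟩ σ _ hσ
    ⟨⟨(hR.mem_atomSet_iff _).2 ⟨p, hp, rfl⟩, Set.singleton_subset_iff.2 hpX⟩, ?_⟩ ?_ ?_
  · rintro ⟨-, h⟩
    exact hpY (Set.singleton_subset_iff.1 h)
  · rw [height_eq_rk, height_eq_rk, e, Nat.cast_add, Nat.cast_one]
  · exact covBy_of_rk hYX e

/-- Every member contains one of its own independent sets, so (i2) forbids a candidate to contain
any member of the given length. -/
lemma exists_memIndep (X : R) :
    ∃ σ, MemIndep X σ ∧ (⋃ T ∈ σ, (T : Set α)) ⊆ X := by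
  induction X using (wellFounded_lt (α := R)).induction with
  | _ X ih =>
    by_cases h0 : rk X = 0
    · exact ⟨∅, MemIndep.zero X (by rw [height_eq_rk, h0, Nat.cast_zero]), by simp⟩
    · obtain ⟨Y, hY, e⟩ := exists_covBy_rk h0
      obtain ⟨σ, hσ, hsub⟩ := ih Y hY.lt
      have hYX : (Y : Set α) ⊂ X := hY.lt
      obtain ⟨p, hpX, hpY⟩ := Set.exists_of_ssubset hYX
      refine ⟨_, hR.memIndep_insert X.2 Y.2 hYX (by rw [famRk_coe, famRk_coe, e]) hpX hpY hσ, ?_⟩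
      rw [Set.biUnion_insert]
      exact Set.union_subset (Set.singleton_subset_iff.2 hpX) (hsub.trans hYX.subset)

end BasicFamily

/-! ### Adding one set to a family -/

/-- A new set only creates new chains below the members that contain it. -/
lemma famRk_union_singleton_le {U Z : Set α} (hZ : Z ∈ R) (hU : ¬ U ⊆ Z) :
    famRk (R ∪ {U}) Z = famRk R Z := by
  have hZ' : Z ∈ R ∪ {U} := Or.inl hZ
  have key : ∀ Y ∈ R ∪ {U}, Y ⊆ Z → Y ∈ R := by
    rintro Y (hY | rfl) h
    · exact hY
    · exact absurd h hU
  refine le_antisymm ?_ ?_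
  · exact famRk_le_of_strictMono_below _ hZ' fun Y hY W hW hYW hWZ =>
      famRk_lt (key Y hY (hYW.subset.trans hWZ)) (key W hW hWZ) hYW
  · exact famRk_le_of_strictMono_below _ hZ fun Y hY W hW hYW hWZ =>
      famRk_lt (Or.inl hY) (Or.inl hW) hYW

lemma famRk_mono {Q : Set (Set α)} (h : R ⊆ Q) {X : Set α} (hX : X ∈ R) :
    famRk R X ≤ famRk Q X :=
  famRk_le_of_strictMono_below _ hX fun _ hY _ hZ hYZ _ => famRk_lt (h hY) (h hZ) hYZ

lemma famRk_union_singleton_self_le {U X : Set α} (hX : X ∈ R) (h : U ⊂ X) :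
    famRk (R ∪ {U}) U ≤ famRk R X := by
  by_contra! hlt
  obtain ⟨Z, hZ, hZU, e⟩ := exists_ssubset_famRk_eq (Or.inr rfl : U ∈ R ∪ {U}) hlt
  have hZR : Z ∈ R := hZ.resolve_right hZU.ne
  rw [famRk_union_singleton_le hZR (fun h' => hZU.not_subset h')] at e
  have := famRk_lt hZR hX (hZU.trans h)
  omega

end Family

/-! ### The families reached by the algorithm keep the ranks of the initial family -/

/-- `R` is a family of subsets of `A` that contains `S`, and the members of `S` have the same rank
in `R` as in `S`. -/
structure RankExtension {α : Type u} (A : Set α) (S R : Set (Set α)) : Prop where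
  sub : ∀ X ∈ R, X ⊆ A
  subset : S ⊆ R
  rank_eq : ∀ X ∈ S, famRk R X = famRk S X

/-- The invariant of the algorithm: a candidate set that was not accepted has a rank that is too
small. -/
def AlgState.Invariant {α : Type u} (A : Set α) (S : Set (Set α)) : AlgState α → Prop
  | .step1 R _ => RankExtension A S R
  | .step2 Q R k _ U => RankExtension A S R ∧ Q = R ∪ {U} ∧ StepOneChoice R k U
  | .step3 Q R k _ U => RankExtension A S R ∧ U ∈ Q ∧ famRk Q U + 1 < k
  | .step4 Q R k _ W => RankExtension A S R ∧ W ∈ Q ∧ famRk Q W + 2 < k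
  | .stopped Q => RankExtension A S Q

section Invariant

variable {α : Type u} [Finite α] {A : Set α} {S R : Set (Set α)}

omit [Finite α] in
lemma RankExtension.basic (hS : BasicFamily A S) (h : RankExtension A S R) : BasicFamily A R :=
  ⟨h.sub, h.subset hS.empty, fun a ha => h.subset (hS.single a ha)⟩

/-- The old rank, extended by the value k - 1 at U, is still strictly increasing: members inside U
have smaller rank because U has length k - 1, and members above U have larger rank by (i3). -/
lemma famRk_union_singleton_of_stepOneChoice {k : ℕ} {U : Set α} (h : StepOneChoice R k U)
    (e : famRk (R ∪ {U}) U = k - 1) {Z : Set α} (hZ : Z ∈ R) :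
    famRk (R ∪ {U}) Z = famRk R Z := by
  classical
  by_cases hU : U ∈ R
  · rw [Set.union_eq_self_of_subset_right (Set.singleton_subset_iff.2 hU)]
  have hmem : U ∈ R ∪ {U} := Or.inr rfl
  have hlow : ∀ Y ∈ R, Y ⊂ U → famRk R Y < k - 1 := by
    intro Y hY hYU
    have h1 := famRk_lt (Or.inl hY : Y ∈ R ∪ {U}) hmem hYU
    have h2 := famRk_mono (Set.subset_union_left : R ⊆ R ∪ {U}) hY
    omega
  have hup : ∀ Y ∈ R, U ⊂ Y → k - 1 < famRk R Y := by
    intro Y hY hUY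
    have h1 := famRk_union_singleton_self_le hY hUY
    have h2 : famRk R Y ≠ k - 1 := fun h' =>
      h.2.not_below ⟨Y, hY⟩ (mem_level_family_iff.2 h') hUY.subset
    omega
  refine le_antisymm ?_ (famRk_mono Set.subset_union_left hZ)
  have := famRk_le_of_strictMono_below (R := R ∪ {U})
    (fun Y => if Y = U then k - 1 else famRk R Y) (Or.inl hZ) (fun Y hY W hW hYW _ => by
      by_cases hYU : Y = U
      · have hWU : W ≠ U := fun h' => hYW.ne (hYU.trans h'.symm)
        simp only [hYU, hWU, if_true, if_false]
        exact hup W (hW.resolve_right hWU) (hYU ▸ hYW)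
      · simp only [hYU, if_false]
        have hYR := hY.resolve_right hYU
        by_cases hWU : W = U
        · simp only [hWU, if_true]
          exact hlow Y hYR (hWU ▸ hYW)
        · simp only [hWU, if_false]
          exact famRk_lt hYR (hW.resolve_right hWU) hYW)
  have hZU : Z ≠ U := fun h' => hU (h' ▸ hZ)
  simpa only [hZU, if_false] using this

lemma RankExtension.insert {k : ℕ} {U : Set α} (hR : RankExtension A S R)
    (h : StepOneChoice R k U) (e : famRk (R ∪ {U}) U = k - 1) :
    RankExtension A S (R ∪ {U}) where
  sub := by
    obtain ⟨⟨X, -, hUX⟩, -⟩ := h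
    rintro Y (hY | rfl)
    · exact hR.sub Y hY
    · exact hUX.subset.trans (hR.sub X X.2)
  subset := hR.subset.trans Set.subset_union_left
  rank_eq X hX := by
    rw [famRk_union_singleton_of_stepOneChoice h e (hR.subset hX), hR.rank_eq X hX]

/-- If U were longer, it would contain a member of length k - 1 and with it an independent set,
against (i2). -/
lemma famRk_le_of_stepOneChoice {k : ℕ} {U : Set α} (hR : BasicFamily A R)
    (h : StepOneChoice R k U) : famRk (R ∪ {U}) U ≤ k - 1 := by
  by_contra! hlt
  obtain ⟨Z, hZ, hZU, e⟩ := exists_ssubset_famRk_eq (Or.inr rfl : U ∈ R ∪ {U}) hlt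
  have hZR : Z ∈ R := hZ.resolve_right hZU.ne
  rw [famRk_union_singleton_le hZR (fun h' => hZU.not_subset h')] at e
  obtain ⟨σ, hσ, hsub⟩ := hR.exists_memIndep ⟨Z, hZR⟩
  exact h.2.not_indep σ ⟨_, mem_level_family_iff.2 e, hσ⟩ (hsub.trans hZU.subset)

lemma AlgState.Invariant.step (hS : BasicFamily A S) {m : ℕ} {s s' : AlgState α}
    (h : s.Invariant A S) (hs : AlgStep m s s') : s'.Invariant A S := by
  cases hs with
  | choose1 R k U hU => exact ⟨h, rfl, hU⟩
  | next1 R k hU hk => exact h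
  | stop1 R k hU hk => exact h
  | accept2 Q R k t U hU =>
    obtain ⟨hR, rfl, hc⟩ := h
    exact hR.insert hc (hasLength_iff.1 hU).2
  | continue2 Q R k t U hU =>
    obtain ⟨hR, rfl, hc⟩ := h
    have hmem : U ∈ R ∪ {U} := Or.inr rfl
    refine ⟨hR, hmem, ?_⟩
    have h1 := famRk_le_of_stepOneChoice (hR.basic hS) hc
    have h2 : famRk (R ∪ {U}) U ≠ k - 1 := fun e => hU (hasLength_iff.2 ⟨hmem, e⟩)
    omega
  | choose3 Q R k t U W hW =>
    obtain ⟨hR, hU, hlt⟩ := h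
    refine ⟨hR, Or.inr rfl, ?_⟩
    have h1 := famRk_union_singleton_self_le hU hW.1
    -- Condition (j3) applied to U itself, which contains W: the length of U is not k - 2, so it
    -- drops below k - 2, and that of W with it.
    have h2 : famRk Q U ≠ k - 2 := fun e =>
      hW.2.not_below ⟨U, hU⟩ (mem_level_family_iff.2 e) hW.1.subset
    omega
  | fail3 Q R k t U hU => exact h.1
  -- Acceptance in Step 4 contradicts the invariant. Every detour through Step 3 therefore ends in
  -- `fail3`, which returns to the old ℛ.
  | accept4 Q R k t W hW =>
    obtain ⟨-, -, hlt⟩ := h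
    have := (hasLength_iff.1 hW).2
    omega
  | continue4 Q R k t W hW =>
    obtain ⟨hR, hU, hlt⟩ := h
    exact ⟨hR, hU, by omega⟩

lemma rankExtension_of_run (hS : BasicFamily A S) {m k : ℕ} {Q : Set (Set α)}
    (h : Relation.ReflTransGen (AlgStep m) (.step1 S k) (.stopped Q)) : RankExtension A S Q := by
  have key : ∀ s, Relation.ReflTransGen (AlgStep m) (.step1 S k) s → s.Invariant A S := by
    intro s hs
    induction hs with
    | refl => exact ⟨hS.sub, subset_rfl, fun _ _ => rfl⟩
    | tail _ hstep ih => exact ih.step hS hstep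
  exact key _ h

end Invariant

/-! ### Geometric families -/

/-- A family of subsets of `A`, with a rank function `r`, that is the family of flats of a simple
matroid on `A`. -/
structure GeomFamily {α : Type u} (A : Set α) (Q : Set (Set α)) (r : Set α → ℕ) : Prop
    extends BasicFamily A Q where
  rank_empty : r ∅ = 0
  rank_lt : ∀ X ∈ Q, ∀ Y ∈ Q, X ⊂ Y → r X < r Y
  step : ∀ X ∈ Q, ∀ p ∈ A, p ∉ X → ∃ C ∈ Q, X ⊆ C ∧ p ∈ C ∧
    (∀ Z ∈ Q, X ⊆ Z → p ∈ Z → C ⊆ Z) ∧ r C = r X + 1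

section Geom

variable {α : Type u} [Finite α] {A : Set α} {Q : Set (Set α)} {r : Set α → ℕ}

/-- (𝔐) is the matroid axiom in this language: adjoining one point to a flat raises the rank by
exactly one. -/
lemma ConditionM.geomFamily (hQ : BasicFamily A Q) (hM : ConditionM Q) :
    GeomFamily A Q (famRk Q) where
  toBasicFamily := hQ
  rank_empty := by
    rw [famRk_of_mem hQ.empty]
    exact rk_isBot ((hQ.isBot_iff _).2 rfl)
  rank_lt _ hX _ hY h := famRk_lt hX hY h
  step X hX p hp hpX := by
    obtain ⟨C, hC, hrk⟩ := hM (famRk Q X) ⟨X, hX⟩ (mem_level_family_iff.2 rfl)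
      ⟨{p}, hQ.single p hp⟩ ⟨(hQ.mem_atomSet_iff _).2 ⟨p, hp, rfl⟩, fun h =>
        hpX (Set.singleton_subset_iff.1 h.2)⟩
    rw [hQ.isFamilyClosure_iff
      (Set.union_subset (hQ.sub X hX) (Set.singleton_subset_iff.2 hp))] at hC
    obtain ⟨h1, h2⟩ := hC
    rw [Set.union_subset_iff] at h1
    refine ⟨C, C.2, h1.1, Set.singleton_subset_iff.1 h1.2, fun Z hZ hXZ hpZ => ?_,
      mem_level_family_iff.1 hrk⟩
    exact h2 Z hZ (Set.union_subset hXZ (Set.singleton_subset_iff.2 hpZ))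

namespace GeomFamily

variable (hQ : GeomFamily A Q r)
include hQ

omit [Finite α] in
lemma eq_of_subset_of_rank {X Y : Set α} (hX : X ∈ Q) (hY : Y ∈ Q) (h : X ⊆ Y)
    (e : r Y ≤ r X) : X = Y := by
  by_contra hne
  have := hQ.rank_lt X hX Y hY (h.ssubset_of_ne hne)
  omega

lemma exists_closure {Y : Set α} (hY : Y ⊆ A) :
    ∃ C ∈ Q, Y ⊆ C ∧ ∀ Z ∈ Q, Y ⊆ Z → C ⊆ Z := by
  induction Y, Y.toFinite using Set.Finite.induction_on with
  | empty => exact ⟨∅, hQ.empty, subset_rfl, fun _ _ h => h⟩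
  | @insert a s ha hs ih =>
    obtain ⟨C, hC, hsC, hleast⟩ := ih ((Set.subset_insert a s).trans hY)
    by_cases haC : a ∈ C
    · exact ⟨C, hC, Set.insert_subset haC hsC, fun Z hZ h =>
        hleast Z hZ ((Set.subset_insert a s).trans h)⟩
    · obtain ⟨D, hD, hCD, haD, hleast', -⟩ := hQ.step C hC a (hY (Set.mem_insert a s)) haC
      exact ⟨D, hD, Set.insert_subset haD (hsC.trans hCD), fun Z hZ h =>
        hleast' Z hZ (hleast Z hZ ((Set.subset_insert a s).trans h)) (h (Set.mem_insert a s))⟩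

lemma ground_mem : A ∈ Q := by
  obtain ⟨C, hC, hAC, -⟩ := hQ.exists_closure subset_rfl
  rwa [hAC.antisymm (hQ.sub C hC)]

lemma inter_mem {X Y : Set α} (hX : X ∈ Q) (hY : Y ∈ Q) : X ∩ Y ∈ Q := by
  obtain ⟨C, hC, hsub, hleast⟩ := hQ.exists_closure (Y := X ∩ Y)
    (Set.inter_subset_left.trans (hQ.sub X hX))
  rwa [hsub.antisymm (Set.subset_inter (hleast X hX Set.inter_subset_left)
    (hleast Y hY Set.inter_subset_right))]

omit [Finite α] in
lemma exists_rank_eq_between {X Y : Set α} (hX : X ∈ Q) (hY : Y ∈ Q) (h : X ⊆ Y) {i : ℕ}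
    (h1 : r X ≤ i) (h2 : i ≤ r Y) : ∃ V ∈ Q, X ⊆ V ∧ V ⊆ Y ∧ r V = i := by
  induction i, h1 using Nat.le_induction with
  | base => exact ⟨X, hX, subset_rfl, h, rfl⟩
  | succ i hi ih =>
    obtain ⟨V, hV, hXV, hVY, e⟩ := ih (by omega)
    have hne : V ≠ Y := by rintro rfl; omega
    obtain ⟨p, hpY, hpV⟩ := Set.exists_of_ssubset (hVY.ssubset_of_ne hne)
    obtain ⟨C, hC, hVC, hpC, hleast, e'⟩ := hQ.step V hV p (hQ.sub Y hY hpY) hpV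
    exact ⟨C, hC, hXV.trans hVC, hleast Y hY hVY hpY, by omega⟩

lemma famRk_eq {X : Set α} (hX : X ∈ Q) : famRk Q X = r X := by
  refine famRk_eq_of_rank r hQ.rank_lt ?_ hX
  intro Z hZ h0
  obtain ⟨V, hV, -, hVZ, e⟩ := hQ.exists_rank_eq_between hQ.empty hZ (Set.empty_subset Z)
    (i := r Z - 1) (by rw [hQ.rank_empty]; omega) (by omega)
  refine ⟨V, hV, hVZ.ssubset_of_ne ?_, by omega⟩
  rintro rfl
  omega

lemma conditionM : ConditionM Q := by
  rintro k X hX T ⟨hT, hTX⟩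
  obtain ⟨p, hp, hTp⟩ := (hQ.mem_atomSet_iff T).1 hT
  have hpX : p ∉ (X : Set α) := fun h => hTX ⟨hT, by
    change (T : Set α) ⊆ X
    rw [hTp]
    exact Set.singleton_subset_iff.2 h⟩
  obtain ⟨C, hC, hXC, hpC, hleast, e⟩ := hQ.step X X.2 p hp hpX
  refine ⟨⟨C, hC⟩, ?_, ?_⟩
  · rw [hTp, hQ.isFamilyClosure_iff
      (Set.union_subset (hQ.sub X X.2) (Set.singleton_subset_iff.2 hp))]
    refine ⟨Set.union_subset hXC (Set.singleton_subset_iff.2 hpC), fun Z hZ h => ?_⟩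
    rw [Set.union_subset_iff] at h
    exact hleast Z hZ h.1 (Set.singleton_subset_iff.1 h.2)
  · rw [mem_level_family_iff, hQ.famRk_eq X.2] at hX
    rw [mem_level_family_iff, hQ.famRk_eq hC, e, hX]

end GeomFamily

end Geom

/-! ### A run of the algorithm that produces a given geometric family -/

section Run

variable {α : Type u} [Finite α] {A : Set α} {Q R : Set (Set α)} {r : Set α → ℕ}

namespace GeomFamily

/-- An independent set of V spans V in 𝒬 as well: since ranks in ℛ and 𝒬 agree, each step from Y to
V is the 𝒬-closure of Y and one point. -/
lemma subset_of_memIndep (hQ : GeomFamily A Q r) (hR : BasicFamily A R) (hRQ : R ⊆ Q)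
    (hrk : ∀ X ∈ R, famRk R X = r X) {V : R} {σ : Set R} (h : MemIndep V σ) {Z : Set α}
    (hZ : Z ∈ Q) (hσ : (⋃ T ∈ σ, (T : Set α)) ⊆ Z) : (V : Set α) ⊆ Z := by
  induction h with
  | zero V hV =>
    rw [height_eq_rk] at hV
    have h0 : rk V = 0 := by exact_mod_cast hV
    have : (V : Set α) ⊆ ∅ :=
      isMin_of_rk_eq_zero h0 (b := ⟨∅, hR.empty⟩) (Set.empty_subset (V : Set α))
    exact this.trans (Set.empty_subset Z)
  | succ V Y σ a hY ha hl hYV ih =>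
    rw [Set.biUnion_insert, Set.union_subset_iff] at hσ
    have hYZ := ih hσ.2
    obtain ⟨p, hp, hap⟩ := (hR.mem_atomSet_iff a).1 ha.1.1
    have hYV' : (Y : Set α) ⊆ V := hYV.le
    have hpV : p ∈ (V : Set α) := by
      have : (a : Set α) ⊆ V := ha.1.2
      rwa [hap, Set.singleton_subset_iff] at this
    have hpY : p ∉ (Y : Set α) := fun h => ha.2 ⟨ha.1.1, by
      change (a : Set α) ⊆ Y
      rwa [hap, Set.singleton_subset_iff]⟩
    have hpZ : p ∈ Z := by
      have := hσ.1
      rwa [hap, Set.singleton_subset_iff] at this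
    obtain ⟨C, hC, -, -, hleast, e⟩ := hQ.step Y (hRQ Y.2) p hp hpY
    have hCV : C = V := by
      refine hQ.eq_of_subset_of_rank hC (hRQ V.2) (hleast V (hRQ V.2) hYV' hpV) ?_
      rw [height_eq_rk, height_eq_rk] at hl
      have hl' : rk V = rk Y + 1 := by exact_mod_cast hl
      rw [← famRk_coe, ← famRk_coe, hrk V V.2, hrk Y Y.2] at hl'
      omega
    rw [← hCV]
    exact hleast Z hZ hYZ hpZ

/-- Greedy choice of a basis: as long as the flat V is smaller than the closure C of U, some point
of U lies outside V and can be adjoined. -/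
lemma exists_memIndep_of_closure (hQ : GeomFamily A Q r) (hR : BasicFamily A R) (hRQ : R ⊆ Q)
    (hrk : ∀ X ∈ R, famRk R X = r X) {U C : Set α} (hUA : U ⊆ A)
    (hC : C ∈ Q) (hUC : U ⊆ C)
    (hleast : ∀ Z ∈ Q, U ⊆ Z → C ⊆ Z) (hfull : ∀ Z ∈ Q, Z ⊆ C → Z ∈ R) {i : ℕ} (hi : i ≤ r C) :
    ∃ V : R, (V : Set α) ⊆ C ∧ r V = i ∧
      ∃ σ, MemIndep V σ ∧ (⋃ T ∈ σ, (T : Set α)) ⊆ U := by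
  induction i with
  | zero =>
    refine ⟨⟨∅, hR.empty⟩, Set.empty_subset C, hQ.rank_empty, ∅, MemIndep.zero _ ?_, by simp⟩
    rw [height_eq_rk, rk_isBot ((hR.isBot_iff _).2 rfl), Nat.cast_zero]
  | succ i ih =>
    obtain ⟨V, hVC, e, σ, hσ, hσU⟩ := ih (by omega)
    have hVQ := hRQ V.2
    obtain ⟨p, hpU, hpV⟩ : ∃ p ∈ U, p ∉ (V : Set α) := by
      by_contra! hsub
      rw [hVC.antisymm (hleast V hVQ hsub)] at e
      omega
    obtain ⟨D, hD, hVD, hpD, hD', eD⟩ := hQ.step V hVQ p (hUA hpU) hpV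
    have hDC := hD' C hC hVC (hUC hpU)
    have hDR := hfull D hD hDC
    refine ⟨⟨D, hDR⟩, hDC, by rw [eD, e], _, hR.memIndep_insert hDR V.2
      (hVD.ssubset_of_ne fun h => hpV (h ▸ hpD)) (by rw [hrk D hDR, hrk V V.2, eD]) hpD hpV hσ, ?_⟩
    rw [Set.biUnion_insert]
    exact Set.union_subset (Set.singleton_subset_iff.2 hpU) hσU

/-- If the 𝒬-closure of U has rank at most k - 1, it lies in a flat of rank k - 1 below X, against
(i3). Otherwise U contains an independent set of rank k - 1, against (i2). -/
lemma not_stepOneChoice (hQ : GeomFamily A Q r) (hR : BasicFamily A R) (hRQ : R ⊆ Q)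
    (hrk : ∀ X ∈ R, famRk R X = r X) {k : ℕ}
    (hfull : ∀ X ∈ R, r X = k → ∀ Z ∈ Q, Z ⊆ X → Z ∈ R) (U : Set α) :
    ¬ StepOneChoice R k U := by
  rintro ⟨⟨X, hX, hUX⟩, hU⟩
  rw [mem_level_family_iff, hrk X X.2] at hX
  have hUA : U ⊆ A := hUX.subset.trans (hR.sub X X.2)
  obtain ⟨C, hC, hUC, hleast⟩ := hQ.exists_closure hUA
  have hCX := hleast X (hRQ X.2) hUX.subset
  have hfull' := fun Z hZ h => hfull X X.2 hX Z hZ h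
  by_cases hle : r C ≤ k - 1
  · obtain ⟨V, hV, hCV, hVX, e⟩ := hQ.exists_rank_eq_between hC (hRQ X.2) hCX hle (by omega)
    have hVR := hfull' V hV hVX
    exact hU.not_below ⟨V, hVR⟩ (mem_level_family_iff.2 (by rw [hrk V hVR, e])) (hUC.trans hCV)
  · obtain ⟨V, -, e, σ, hσ, hσU⟩ := hQ.exists_memIndep_of_closure hR hRQ hrk hUA hC hUC hleast
      (fun Z hZ h => hfull' Z hZ (h.trans hCX)) (i := k - 1) (by omega)
    exact hU.not_indep σ ⟨V, mem_level_family_iff.2 (by rw [hrk V V.2, e]), hσ⟩ hσU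

/-- For (i1), the 𝒬-closure of Y lies below V, whose rank is less than k, so it already belongs to
ℛ. A failure of (i2) or (i3) would identify U with a member of ℛ of the same rank. -/
lemma stepOneChoice (hQ : GeomFamily A Q r) (hR : BasicFamily A R) (hRQ : R ⊆ Q)
    (hrk : ∀ X ∈ R, famRk R X = r X) {k : ℕ} (hk : 1 ≤ k)
    (hfull : ∀ X ∈ R, r X < k → ∀ Z ∈ Q, Z ⊆ X → Z ∈ R) {X U : Set α} (hX : X ∈ R)
    (hXk : r X = k) (hU : U ∈ Q) (hUR : U ∉ R) (hUX : U ⊆ X) (hUk : r U = k - 1) :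
    StepOneChoice R k U := by
  refine ⟨⟨⟨X, hX⟩, mem_level_family_iff.2 (by rw [hrk X hX, hXk]),
    hUX.ssubset_of_ne fun h => hUR (h ▸ hX)⟩, ?_, ?_, ?_⟩
  · intro V hV Y hY
    rw [mem_level_family_iff, hrk V V.2] at hV
    rw [Set.subset_inter_iff] at hY
    have hYA := hY.1.trans (hQ.sub U hU)
    obtain ⟨C, hC, hYC, hleast⟩ := hQ.exists_closure hYA
    have hCR := hfull V V.2 (by omega) C hC (hleast V (hRQ V.2) hY.2)
    exact ⟨⟨C, hCR⟩, (hR.isFamilyClosure_iff hYA _).2 ⟨hYC, fun Z hZ => hleast Z (hRQ hZ)⟩,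
      hleast U hU hY.1⟩
  · rintro σ ⟨V, hV, hσ⟩ hsub
    rw [mem_level_family_iff, hrk V V.2] at hV
    have hVU := hQ.subset_of_memIndep hR hRQ hrk hσ hU hsub
    exact hUR (hQ.eq_of_subset_of_rank (hRQ V.2) hU hVU (by omega) ▸ V.2)
  · intro V hV hUV
    rw [mem_level_family_iff, hrk V V.2] at hV
    exact hUR (hQ.eq_of_subset_of_rank hU (hRQ V.2) hUV (by omega) ▸ V.2)

/-- The member Y of ℛ below U makes the length of U in ℛ ∪ {U} equal to k - 1, so that Step 2
accepts U. -/
lemma exists_missing_hyperplane (hQ : GeomFamily A Q r) (hRQ : R ⊆ Q)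
    (hrk : ∀ X ∈ R, famRk R X = r X) {k : ℕ}
    (hfull : ∀ X ∈ R, r X < k → ∀ Z ∈ Q, Z ⊆ X → Z ∈ R) {X Z : Set α} (hX : X ∈ R)
    (hXk : r X = k) (hZ : Z ∈ Q) (hZX : Z ⊆ X) (hZR : Z ∉ R) :
    ∃ U ∈ Q, U ∉ R ∧ U ⊆ X ∧ r U = k - 1 ∧ ∃ Y ∈ R, Y ⊂ U ∧ r U = r Y + 1 := by
  have hXQ := hRQ hX
  have hZk : r Z < k := hXk ▸ hQ.rank_lt Z hZ X hXQ (hZX.ssubset_of_ne fun h => hZR (h ▸ hX))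
  obtain ⟨U₀, hU₀, hZU₀, hU₀X, eU₀⟩ :=
    hQ.exists_rank_eq_between hZ hXQ hZX (i := k - 1) (by omega) (by omega)
  have hU₀R : U₀ ∉ R := fun h => hZR (hfull U₀ h (by omega) Z hZ hZU₀)
  obtain ⟨V, hV, hVX, eV⟩ := exists_ssubset_famRk_eq hX (n := k - 1)
    (by rw [hrk X hX, hXk]; omega)
  rw [hrk V hV] at eV
  have hVQ := hRQ hV
  -- Exchange argument: fix a hyperplane V ∈ ℛ of X and take a missing hyperplane U with r (U ∩ V)
  -- maximal. Replacing a point of U outside Y ⊇ U ∩ V by some b ∈ V enlarges the intersection, so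
  -- the new hyperplane U' lies in ℛ, and hence so does Y ⊆ U'.
  obtain ⟨U, ⟨hU, hUR, hUX, eU⟩, hmax⟩ := Set.exists_max_image
    {U | U ∈ Q ∧ U ∉ R ∧ U ⊆ X ∧ r U = k - 1} (fun U => r (U ∩ V)) (Set.toFinite _)
    ⟨U₀, hU₀, hU₀R, hU₀X, eU₀⟩
  refine ⟨U, hU, hUR, hUX, eU, ?_⟩
  have hW := hQ.inter_mem hU hVQ
  have hVU : ¬ V ⊆ U := fun h => hUR (hQ.eq_of_subset_of_rank hVQ hU h (by omega) ▸ hV)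
  have hUV : ¬ U ⊆ V := fun h => hUR (hQ.eq_of_subset_of_rank hU hVQ h (by omega) ▸ hV)
  have hWlt : r (U ∩ V) < r U := hQ.rank_lt _ hW U hU
    (Set.inter_subset_left.ssubset_of_ne fun h => hUV (Set.inter_eq_left.1 h))
  obtain ⟨Y, hY, hWY, hYU, eY⟩ := hQ.exists_rank_eq_between hW hU Set.inter_subset_left
    (i := k - 2) (by omega) (by omega)
  obtain ⟨b, hbV, hbU⟩ := Set.not_subset.1 hVU
  have hbX := hVX.subset hbV
  obtain ⟨U', hU', hYU', hbU', hleast, eU'⟩ := hQ.step Y hY b (hQ.sub X hXQ hbX)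
    fun h => hbU (hYU h)
  have hU'X := hleast X hXQ (hYU.trans hUX) hbX
  have hlt : r (U ∩ V) < r (U' ∩ V) := by
    refine hQ.rank_lt _ hW _ (hQ.inter_mem hU' hVQ) (Set.ssubset_iff_exists.2
      ⟨Set.subset_inter (hWY.trans hYU') Set.inter_subset_right, b, ⟨hbU', hbV⟩,
        fun h => hbU h.1⟩)
  have hU'R : U' ∈ R := by
    by_contra hU'R
    have := hmax U' ⟨hU', hU'R, hU'X, by omega⟩
    omega
  exact ⟨Y, hfull U' hU'R (by omega) Y hY hYU', hYU.ssubset_of_ne (by rintro rfl; omega),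
    by omega⟩

end GeomFamily

omit [Finite α] in
lemma reflTransGen_step1_of_no_choice {m k : ℕ} (h3 : 3 ≤ k) (hkm : k ≤ max 3 m)
    (h : ∀ i < k, ∀ U, ¬ StepOneChoice R i U) :
    Relation.ReflTransGen (AlgStep m) (.step1 R 3) (.step1 R k) := by
  induction k, h3 using Nat.le_induction with
  | base => exact .refl
  | succ k hk ih =>
    exact (ih (by omega) fun i hi => h i (by omega)).tail
      (.next1 R k (h k (by omega)) (by omega))

lemma GeomFamily.exists_run (hQ : GeomFamily A Q r) (hR : BasicFamily A R) (hRQ : R ⊆ Q)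
    (hA : A ∈ R) (hrk : ∀ X ∈ R, famRk R X = r X) :
    Relation.ReflTransGen (AlgStep (r A)) (.step1 R 3) (.stopped Q) := by
  classical
  induction hn : (Q \ R).ncard using Nat.strong_induction_on generalizing R with
  | _ n ih =>
    by_cases hfull : ∀ X ∈ R, ∀ Z ∈ Q, Z ⊆ X → Z ∈ R
    · have hno := fun i U => hQ.not_stepOneChoice hR hRQ hrk (k := i)
        (fun X hX _ => hfull X hX) U
      obtain rfl : R = Q := hRQ.antisymm fun Z hZ => hfull A hA Z hZ (hQ.sub Z hZ)
      -- The maximum covers lengths below 3, where the algorithm stops at its initial value k = 3.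
      exact (reflTransGen_step1_of_no_choice (m := r A) (k := max 3 (r A)) (le_max_left _ _) le_rfl
        fun i _ => hno i).tail (.stop1 R _ (hno _) (by omega))
    · have hex : ∃ k, ∃ X ∈ R, r X = k ∧ ∃ Z ∈ Q, Z ⊆ X ∧ Z ∉ R := by
        push Not at hfull
        obtain ⟨X, hX, Z, hZ⟩ := hfull
        exact ⟨_, X, hX, rfl, Z, hZ⟩
      obtain ⟨X, hX, hXk, Z, hZ, hZX, hZR⟩ := Nat.find_spec hex
      set k := Nat.find hex with hkdef
      have hmin : ∀ Y ∈ R, r Y < k → ∀ Z ∈ Q, Z ⊆ Y → Z ∈ R := by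
        intro Y hY hYk Z' hZ' hZ'Y
        by_contra hZ'R
        exact Nat.find_min hex hYk ⟨Y, hY, rfl, Z', hZ', hZ'Y, hZ'R⟩
      obtain ⟨U, hU, hUR, hUX, eU, Y, hY, hYU, eY⟩ :=
        hQ.exists_missing_hyperplane hRQ hrk hmin hX hXk hZ hZX hZR
      -- This gives k ≥ 3, the value at which the search starts: a set U of rank 1 would be a
      -- singleton and hence in ℛ.
      have hYne : Y ≠ ∅ := by
        rintro rfl
        obtain ⟨p, hpU, -⟩ := Set.exists_of_ssubset hYU
        have hp := hQ.sub U hU hpU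
        have hpU' : {p} ⊆ U := Set.singleton_subset_iff.2 hpU
        have h0 : r ∅ < r {p} := hQ.rank_lt _ hQ.empty _ (hQ.single p hp)
          (Set.empty_ssubset.2 (Set.singleton_nonempty p))
        exact hUR (hQ.eq_of_subset_of_rank (hQ.single p hp) hU hpU' (by omega) ▸ hR.single p hp)
      have hY1 : r ∅ < r Y := hQ.rank_lt _ hQ.empty _ (hRQ hY)
        (Set.empty_ssubset.2 (Set.nonempty_iff_ne_empty.2 hYne))
      have hchoice := hQ.stepOneChoice hR hRQ hrk (by omega) hmin hX hXk hU hUR hUX eU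
      have hkm : k ≤ r A := by
        rw [← hXk]
        rcases (hR.sub X hX).eq_or_ssubset with h | h
        · rw [h]
        · exact (hQ.rank_lt X (hRQ hX) A (hRQ hA) h).le
      have hR' : BasicFamily A (R ∪ {U}) :=
        ⟨by rintro W (hW | rfl); exacts [hR.sub W hW, hQ.sub W hU], Or.inl hR.empty,
          fun a ha => Or.inl (hR.single a ha)⟩
      have hRQ' : R ∪ {U} ⊆ Q := Set.union_subset hRQ (Set.singleton_subset_iff.2 hU)
      have hrk' : ∀ W ∈ R ∪ {U}, famRk (R ∪ {U}) W = r W := by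
        intro W hW
        refine famRk_eq_of_rank r
          (fun X hX Y hY => hQ.rank_lt X (hRQ' hX) Y (hRQ' hY)) ?_ hW
        rintro T (hT | rfl) h0
        · obtain ⟨S, hS, hST, eS⟩ := exists_ssubset_famRk_eq hT (n := r T - 1)
            (by rw [hrk T hT]; omega)
          rw [hrk S hS] at eS
          exact ⟨S, Or.inl hS, hST, by omega⟩
        · exact ⟨Y, Or.inl hY, hYU, eY⟩
      have hdec : (Q \ (R ∪ {U})).ncard < (Q \ R).ncard := by
        refine Set.ncard_lt_ncard (Set.ssubset_iff_exists.2
          ⟨Set.sdiff_subset_sdiff_right Set.subset_union_left, U, ⟨hU, hUR⟩, fun h => h.2 (Or.inr rfl)⟩)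
          (Set.toFinite _)
      have hacc : HasLength (R ∪ {U}) U (k - 1) :=
        hasLength_iff.2 ⟨Or.inr rfl, by rw [hrk' U (Or.inr rfl), eU]⟩
      have hrec := ih _ (hn ▸ hdec) hR' hRQ' (Or.inl hA) hrk' rfl
      refine (reflTransGen_step1_of_no_choice (k := k) (by omega) (by omega) fun i hi =>
        hQ.not_stepOneChoice hR hRQ hrk fun X hX hXi => hmin X hX (by omega)).trans ?_
      exact .head (.choose1 R k U hchoice) (.head (.accept2 _ R k k U hacc) hrec)

end Run

/-! ### The lattice of a geometric family -/

section FlatLattice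

variable {α : Type u} [Finite α] {A : Set α} {Q : Set (Set α)} {r : Set α → ℕ}

namespace GeomFamily

lemma exists_closure_union (hQ : GeomFamily A Q r) (X Y : Q) :
    ∃ C ∈ Q, (X ∪ Y : Set α) ⊆ C ∧ ∀ Z ∈ Q, (X ∪ Y : Set α) ⊆ Z → C ⊆ Z :=
  hQ.exists_closure (Set.union_subset (hQ.sub X X.2) (hQ.sub Y Y.2))

/-- The lattice structure of a geometric family. -/
@[reducible] noncomputable def lattice (hQ : GeomFamily A Q r) : Lattice Q where
  __ := (inferInstance : PartialOrder Q)
  sup X Y := ⟨(hQ.exists_closure_union X Y).choose, (hQ.exists_closure_union X Y).choose_spec.1⟩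
  inf X Y := ⟨X ∩ Y, hQ.inter_mem X.2 Y.2⟩
  le_sup_left X Y :=
    Set.subset_union_left.trans (hQ.exists_closure_union X Y).choose_spec.2.1
  le_sup_right X Y :=
    Set.subset_union_right.trans (hQ.exists_closure_union X Y).choose_spec.2.1
  sup_le X Y Z hX hY :=
    (hQ.exists_closure_union X Y).choose_spec.2.2 Z Z.2 (Set.union_subset hX hY)
  inf_le_left X Y := (Set.inter_subset_left : (X ∩ Y : Set α) ⊆ X)
  inf_le_right X Y := (Set.inter_subset_right : (X ∩ Y : Set α) ⊆ Y)
  le_inf X Y Z hX hY := (Set.subset_inter hX hY : (X : Set α) ⊆ Y ∩ Z)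

omit [Finite α] in
lemma isLUB_atoms (hQ : GeomFamily A Q r) (X : Q) :
    IsLUB {T : Q | T ∈ atomSet Q ∧ (T : Set α) ⊆ X} X :=
  (hQ.isFamilyClosure_iff (hQ.sub X X.2) X).2 ⟨subset_rfl, fun _ _ h => h⟩

lemma isFiniteGeometric (hQ : GeomFamily A Q r) : @IsFiniteGeometric Q hQ.lattice := by
  let := hQ.lattice
  refine ⟨inferInstance, ⟨fun {X Y} hXY => ?_⟩, fun X =>
    ⟨_, fun T hT => hT.1, hQ.isLUB_atoms X⟩⟩
  have hlt : ((X ⊓ Y : Q) : Set α) ⊂ X := hXY.lt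
  obtain ⟨p, hpX, hpXY⟩ := Set.exists_of_ssubset hlt
  have hpY : p ∉ (Y : Set α) := fun h => hpXY ⟨hpX, h⟩
  have hp := hQ.sub X X.2 hpX
  obtain ⟨C, hC, hYC, hpC, hleast, e⟩ := hQ.step Y Y.2 p hp hpY
  -- X ∩ C contains p and so exceeds X ∩ Y; as X covers X ∩ Y, this forces X ∩ C = X.
  have hXC : (X : Set α) ⊆ C := by
    have h1 : (X ⊓ Y : Q) < X ⊓ ⟨C, hC⟩ := by
      change (X ∩ Y : Set α) ⊂ X ∩ C
      exact Set.ssubset_iff_exists.2 ⟨Set.inter_subset_inter_right _ hYC, p, ⟨hpX, hpC⟩, hpXY⟩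
    have h2 : X ⊓ (⟨C, hC⟩ : Q) = X := eq_of_le_of_not_lt inf_le_left (hXY.2 h1)
    exact (inf_eq_left.1 h2 : X ≤ ⟨C, hC⟩)
  have hsup : X ⊔ Y = ⟨C, hC⟩ := by
    refine le_antisymm (sup_le hXC hYC) ?_
    exact hleast _ (X ⊔ Y).2 (le_sup_right : Y ≤ X ⊔ Y) ((le_sup_left : X ≤ X ⊔ Y) hpX)
  rw [hsup]
  refine covBy_of_rk ?_ ?_
  · change (Y : Set α) ⊂ C
    exact hYC.ssubset_of_ne fun h => hpY (h ▸ hpC)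
  · rw [← famRk_coe, ← famRk_coe, hQ.famRk_eq hC, hQ.famRk_eq Y.2, e]

end GeomFamily

end FlatLattice

/-! ### Cover-preserving embeddings and transport along order isomorphisms -/

/-- A rank-preserving order embedding of a finite semimodular lattice that preserves meets also
preserves joins. -/
lemma coverPreservingEmbeds_of_rk {L : Type u} {K : Type v} [Lattice L] [Finite L]
    [IsUpperModularLattice L] [Lattice K] [Finite K] (f : L → K)
    (hinf : ∀ x y, f (x ⊓ y) = f x ⊓ f y) (hinj : Function.Injective f)
    (hrk : ∀ x, rk (f x) = rk x) : CoverPreservingEmbeds L K := by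
  have hmono : Monotone f := fun x y h => by
    rw [← inf_eq_left, ← hinf, inf_eq_left.2 h]
  have hcov : ∀ a b : L, a ⋖ b → f a ⋖ f b := fun a b h =>
    covBy_of_rk ((hmono h.le).lt_of_ne fun e => h.ne (hinj e)) (by rw [hrk, hrk, rk_covBy h])
  -- Climb from a common lower bound z to x one cover t at a time, replacing y by t ⊔ y. If t ≰ y,
  -- then f (t ⊔ y) covers f y; since f reflects the order, f t ≰ f y, hence f t ⊔ f y = f (t ⊔ y).
  have key : ∀ n : ℕ, ∀ z x y : L, z ≤ x → z ≤ y → rk x - rk z = n → f (x ⊔ y) ≤ f x ⊔ f y := by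
    intro n
    induction n with
    | zero =>
      intro z x y hx hy e
      have : z = x := by
        by_contra hne
        have := rk_lt_rk (hx.lt_of_ne hne)
        omega
      subst this
      rw [sup_eq_right.2 hy]
      exact le_sup_right
    | succ n ih =>
      intro z x y hx hy e
      have hlt : z < x := hx.lt_of_ne (by rintro rfl; omega)
      obtain ⟨t, hzt, htx⟩ := exists_covBy_le_of_lt hlt
      have et := rk_covBy hzt
      have h1 := ih t x (t ⊔ y) htx le_sup_left (by omega)
      rw [← sup_assoc, sup_eq_left.2 htx] at h1
      refine h1.trans (sup_le le_sup_left ?_)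
      by_cases hty : t ≤ y
      · rw [sup_eq_right.2 hty]
        exact le_sup_right
      · have hz : t ⊓ y = z := (hzt.eq_or_eq (le_inf hzt.le hy) inf_le_left).resolve_right
          fun h => hty (inf_eq_left.1 h)
        have hc := hcov _ _ (IsUpperModularLattice.covBy_sup_of_inf_covBy (by rw [hz]; exact hzt) :
          y ⋖ t ⊔ y)
        rcases hc.eq_or_eq (c := f t ⊔ f y) le_sup_right
          (sup_le (hmono le_sup_left) (hmono le_sup_right)) with h | h
        · have h2 : f t ≤ f y := h ▸ le_sup_left
          rw [← inf_eq_left, ← hinf] at h2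
          exact absurd (inf_eq_left.1 (hinj h2)) hty
        · rw [← h]
          exact sup_le_sup (hmono htx) le_rfl
  exact ⟨{ toFun := f
           map_sup' := fun x y => le_antisymm
            (key _ (x ⊓ y) x y inf_le_left inf_le_right rfl)
            (sup_le (hmono le_sup_left) (hmono le_sup_right))
           map_inf' := hinf }, hinj, hcov⟩

lemma atomSet_map {P : Type u} {Q : Type v} [PartialOrder P] [PartialOrder Q] (e : P ≃o Q) {a : P}
    (h : a ∈ atomSet P) : e a ∈ atomSet Q := by
  obtain ⟨b, hb, hba⟩ := h
  refine ⟨e b, fun q => ?_, ?_⟩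
  · rw [← e.le_symm_apply]
    exact hb _
  · exact (apply_covBy_apply_iff e).2 hba

lemma atomSet_image {P : Type u} {Q : Type v} [PartialOrder P] [PartialOrder Q] (e : P ≃o Q) :
    e '' atomSet P = atomSet Q := by
  ext q
  constructor
  · rintro ⟨a, ha, rfl⟩
    exact atomSet_map e ha
  · intro hq
    exact ⟨e.symm q, atomSet_map e.symm hq, e.apply_symm_apply q⟩

lemma IsFiniteGeometric.of_orderIso {K : Type u} {K' : Type v} [Lattice K] [Lattice K']
    (h : IsFiniteGeometric K) (e : K ≃o K') : IsFiniteGeometric K' := by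
  obtain ⟨hfin, hmod, hat⟩ := h
  refine ⟨Finite.of_equiv K e.toEquiv, ⟨fun {a b} hab => ?_⟩, fun x => ?_⟩
  · rw [← apply_covBy_apply_iff e.symm, map_sup]
    rw [← apply_covBy_apply_iff e.symm, map_inf] at hab
    exact IsUpperModularLattice.covBy_sup_of_inf_covBy hab
  · obtain ⟨s, hs, hlub⟩ := hat (e.symm x)
    refine ⟨e '' s, ?_, ?_⟩
    · rw [← atomSet_image e]
      exact Set.image_mono hs
    · rw [← e.apply_symm_apply x]
      exact (e.isLUB_image').2 hlub

lemma CoverPreservingEmbeds.of_orderIso {L : Type w} {K : Type u} {K' : Type v} [Lattice L]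
    [Lattice K] [Lattice K'] (h : CoverPreservingEmbeds L K) (e : K ≃o K') :
    CoverPreservingEmbeds L K' := by
  obtain ⟨f, hinj, hcov⟩ := h
  refine ⟨(⟨⟨e, map_sup e⟩, map_inf e⟩ : LatticeHom K K').comp f, e.injective.comp hinj, fun a b hab => ?_⟩
  exact (apply_covBy_apply_iff e).2 (hcov a b hab)

/-- The lattice structure carried over along an equivalence. -/
@[reducible] def Equiv.transportLattice {K : Type u} {K' : Type v} [Lattice K] (e : K' ≃ K) :
    Lattice K' where
  __ := PartialOrder.lift e e.injective
  sup a b := e.symm (e a ⊔ e b)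
  inf a b := e.symm (e a ⊓ e b)
  le_sup_left a b := by change e a ≤ e (e.symm _); simp
  le_sup_right a b := by change e b ≤ e (e.symm _); simp
  sup_le a b c hac hbc := by
    change e (e.symm _) ≤ e c
    simpa using ⟨hac, hbc⟩
  inf_le_left a b := by change e (e.symm _) ≤ e a; simp
  inf_le_right a b := by change e (e.symm _) ≤ e b; simp
  le_inf a b c hab hac := by
    change e a ≤ e (e.symm _)
    simpa using ⟨hab, hac⟩

lemma IsBestExtension.card_le_of_equiv {L : Type u} {G : Type v} [Lattice L] [Lattice G]
    (hG : IsBestExtension L G) {K : Type w} [Lattice K] (hK : IsFiniteGeometric K)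
    (hL : CoverPreservingEmbeds L K) {K' : Type v} (ε : K' ≃ K) : Nat.card G ≤ Nat.card K := by
  let := ε.transportLattice
  let e : K ≃o K' := OrderIso.symm { toEquiv := ε, map_rel_iff' := Iff.rfl }
  have := hG.2 _ (hK.of_orderIso e) (hL.of_orderIso e)
  rwa [Nat.card_congr ε] at this

/-- Minimality of G is stated within its own universe; a competitor K from another universe is
finite and can be copied there. -/
lemma IsBestExtension.card_le {L : Type u} {G : Type v} [Lattice L] [Lattice G]
    (hG : IsBestExtension L G) {K : Type w} [Lattice K] (hK : IsFiniteGeometric K)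
    (hL : CoverPreservingEmbeds L K) : Nat.card G ≤ Nat.card K :=
  have := hK.1
  hG.card_le_of_equiv hK hL
    (Equiv.ulift.trans (Finite.equivFin K).symm : ULift.{v} (Fin (Nat.card K)) ≃ K)

/-! ### The family of an extending standard form -/

lemma eq_of_mem_atomSet_of_le {P : Type u} [PartialOrder P] {p q : P} (hp : p ∈ atomSet P)
    (hq : q ∈ atomSet P) (h : q ≤ p) : q = p := by
  obtain ⟨b, hb, hbp⟩ := hp
  obtain ⟨c, hc, hcq⟩ := hq
  obtain rfl : b = c := le_antisymm (hb c) (hc b)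
  exact (hbp.eq_or_eq hcq.le h).resolve_left hcq.ne'

lemma mem_atomSet_iff_bot_covBy {P : Type u} [PartialOrder P] [OrderBot P] {a : P} :
    a ∈ atomSet P ↔ ⊥ ⋖ a := by
  constructor
  · rintro ⟨b, hb, hba⟩
    rwa [← hb.eq_bot]
  · exact fun h => ⟨⊥, isBot_bot, h⟩

lemma le_of_forall_supIrred_le {L : Type u} [Lattice L] [Finite L] {x y : L}
    (hbot : ∀ z : L, IsMin z → z ≤ y)
    (h : ∀ j, SupIrred j → j ≤ x → j ≤ y) : x ≤ y := by
  induction x using (wellFounded_lt (α := L)).induction with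
  | _ x ih =>
    by_cases hx : SupIrred x
    · exact h x hx le_rfl
    · rcases not_supIrred.1 hx with hx | ⟨b, c, rfl, hb, hc⟩
      · exact hbot x hx
      · exact sup_le (ih b hb fun j hj hjb => h j hj (hjb.trans hb.le))
          (ih c hc fun j hj hjc => h j hj (hjc.trans hc.le))

namespace StandardForm

open Carrier

variable {L : Type u} [Lattice L] (E : StandardForm L)

instance [Finite L] : Finite E.Carrier := by
  have := E.finite_D
  refine Finite.of_injective (β := L ⊕ E.D)
    (fun p => match p with | .old x => .inl x | .new d => .inr d) ?_
  rintro (x | d) (y | e) h <;> simp_all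

/-- The element of `L` that an atom of the standard form comes from. -/
def Carrier.origin {E : StandardForm L} : E.Carrier → L
  | .old x => x
  | .new d => E.base d

lemma le_old_iff {E : StandardForm L} (p : E.Carrier) (x : L) : p ≤ .old x ↔ p.origin ≤ x := by
  cases p <;> exact Iff.rfl

lemma mem_atomsBelow_old {E : StandardForm L} {p : E.Carrier} {x : L} :
    p ∈ atomsBelow (.old x : E.Carrier) ↔ p ∈ atomSet E.Carrier ∧ p.origin ≤ x := by
  rw [← le_old_iff]
  exact Iff.rfl

lemma atomsBelow_of_mem {E : StandardForm L} {p : E.Carrier} (hp : p ∈ atomSet E.Carrier) :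
    atomsBelow p = {p} := by
  ext q
  constructor
  · rintro ⟨hq, hqp⟩
    exact eq_of_mem_atomSet_of_le hp hq hqp
  · rintro rfl
    exact ⟨hp, le_rfl⟩

lemma atomsBelow_old_inf {E : StandardForm L} (x y : L) :
    atomsBelow (.old (x ⊓ y) : E.Carrier) = atomsBelow (.old x) ∩ atomsBelow (.old y) := by
  ext p
  simp only [Set.mem_inter_iff, mem_atomsBelow_old, le_inf_iff]
  tauto

variable [OrderBot L]

lemma isBot_old_bot : IsBot (.old ⊥ : E.Carrier) := by
  rintro (x | d)
  · exact (bot_le : (⊥ : L) ≤ x)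
  · exact (isBot_bot : IsBot (⊥ : L))

variable {E}

lemma eq_of_isBot {p : E.Carrier} (h : IsBot p) : p = .old ⊥ :=
  le_antisymm (h _) (E.isBot_old_bot p)

lemma not_new_le_old_bot (d : E.D) : ¬ (.new d : E.Carrier) ≤ .old ⊥ := fun h =>
  (E.base_mem d).2 (by rw [le_bot_iff.1 (h : E.base d ≤ ⊥)]; exact isBot_bot)

lemma new_mem_atomSet (d : E.D) : (.new d : E.Carrier) ∈ atomSet E.Carrier := by
  refine ⟨.old ⊥, E.isBot_old_bot, lt_of_le_not_ge (E.isBot_old_bot _) (not_new_le_old_bot d), ?_⟩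
  rintro (x | e) h1 h2
  · exact h1.not_ge ((h2.le : IsBot x) _)
  · exact h2.ne (congrArg _ (h2.le : e = d))

lemma old_mem_atomSet {a : L} (ha : a ∈ atomSet L) : (.old a : E.Carrier) ∈ atomSet E.Carrier := by
  rw [mem_atomSet_iff_bot_covBy] at ha
  refine ⟨.old ⊥, E.isBot_old_bot,
    lt_of_le_not_ge (E.isBot_old_bot _) fun h => ha.lt.not_ge h, ?_⟩
  rintro (x | e) h1 h2
  · refine ha.2 (c := x) (bot_lt_iff_ne_bot.2 ?_)
      (lt_of_le_not_ge (h2.le : x ≤ a) fun h => h2.not_ge h)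
    rintro rfl
    exact h1.ne rfl
  · have h3 : E.base e ≤ a := h2.le
    rcases ha.eq_or_eq bot_le h3 with h | h
    · exact (E.base_mem e).2 (h ▸ isBot_bot)
    · exact (E.base_mem e).1 (h ▸ mem_atomSet_iff_bot_covBy.2 ha)

lemma mem_atomSet_of_old {a : L} (h : (.old a : E.Carrier) ∈ atomSet E.Carrier) :
    a ∈ atomSet L := by
  obtain ⟨b, hb, hba⟩ := h
  rw [eq_of_isBot hb] at hba
  rw [mem_atomSet_iff_bot_covBy]
  refine ⟨lt_of_le_not_ge bot_le fun h => hba.lt.not_ge h, fun c h1 h2 => ?_⟩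
  exact hba.2 (c := .old c) (lt_of_le_not_ge h1.le fun h => h1.not_ge h)
    (lt_of_le_not_ge h2.le fun h => h2.not_ge h)

lemma supIrred_of_mem_atomSet {a : L} (ha : a ∈ atomSet L) : SupIrred a := by
  rw [mem_atomSet_iff_bot_covBy] at ha
  refine ⟨fun h => ha.lt.not_ge (h bot_le), fun b c h => ?_⟩
  rcases ha.eq_or_eq bot_le (h ▸ le_sup_left : b ≤ a) with hb | hb
  · right
    rwa [hb, bot_sup_eq] at h
  · exact Or.inl hb

lemma exists_origin_eq {j : L} (hj : SupIrred j) : ∃ p ∈ atomSet E.Carrier, p.origin = j := by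
  by_cases ha : j ∈ atomSet L
  · exact ⟨.old j, old_mem_atomSet ha, rfl⟩
  · obtain ⟨d, rfl⟩ := E.exists_base j ⟨hj, ha, fun h => hj.1 h.isMin⟩
    exact ⟨.new d, new_mem_atomSet d, rfl⟩

lemma origin_ne_bot {p : E.Carrier} (hp : p ∈ atomSet E.Carrier) : p.origin ≠ ⊥ := by
  rcases p with a | d
  · have := mem_atomSet_iff_bot_covBy.1 (mem_atomSet_of_old hp)
    exact this.ne'
  · exact fun h => (E.base_mem d).2 (by
      rw [show E.base d = ⊥ from h]
      exact isBot_bot)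

variable [Finite L]

/-- Every join-irreducible is the origin of an atom, so A(x) determines the join-irreducibles below
x and thereby x. -/
lemma atomsBelow_old_subset_iff {x y : L} :
    atomsBelow (.old x : E.Carrier) ⊆ atomsBelow (.old y) ↔ x ≤ y := by
  constructor
  · intro h
    refine le_of_forall_supIrred_le (fun z hz => hz.eq_bot ▸ bot_le) fun j hj hjx => ?_
    obtain ⟨p, hp, rfl⟩ := exists_origin_eq (E := E) hj
    exact (mem_atomsBelow_old.1 (h (mem_atomsBelow_old.2 ⟨hp, hjx⟩))).2
  · intro h p hp
    rw [mem_atomsBelow_old] at hp ⊢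
    exact ⟨hp.1, hp.2.trans h⟩

lemma atomsBelow_old_injective :
    Function.Injective fun x : L => atomsBelow (.old x : E.Carrier) := fun _ _ h =>
  le_antisymm (atomsBelow_old_subset_iff.1 h.subset) (atomsBelow_old_subset_iff.1 h.superset)

lemma atomsBelow_old_ssubset {x y : L} (h : x < y) :
    atomsBelow (.old x : E.Carrier) ⊂ atomsBelow (.old y) :=
  (atomsBelow_old_subset_iff.2 h.le).ssubset_of_ne fun e => h.ne (atomsBelow_old_injective e)

variable (E)

omit [Finite L] in
lemma atomsBelow_old_bot : atomsBelow (.old ⊥ : E.Carrier) = ∅ := by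
  ext p
  rw [mem_atomsBelow_old, le_bot_iff]
  exact ⟨fun h => origin_ne_bot h.1 h.2, fun h => h.elim⟩

omit [Finite L] in
lemma basicFamily_atomFamily : BasicFamily (atomSet E.Carrier) (atomFamily E.Carrier) where
  sub := by
    rintro _ ⟨x, rfl⟩ p hp
    exact hp.1
  empty := ⟨.old ⊥, E.atomsBelow_old_bot⟩
  single p hp := ⟨p, atomsBelow_of_mem hp⟩

lemma two_le_rk_base (d : E.D) : 2 ≤ rk (E.base d) := by
  have h0 : rk (E.base d) ≠ 0 := fun h =>
    (E.base_mem d).2 ((isMin_of_rk_eq_zero h).eq_bot ▸ isBot_bot)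
  obtain ⟨y, hy, e⟩ := exists_covBy_rk h0
  have h1 : rk y ≠ 0 := fun h => (E.base_mem d).1
    (mem_atomSet_iff_bot_covBy.2 ((isMin_of_rk_eq_zero h).eq_bot ▸ hy))
  omega

/-- The inserted atoms lengthen no chain: each has rank 1, while its base has rank at least 2. The
function ρ, with value rk y on A(y) and 1 on the inserted singletons, is strictly increasing. -/
lemma famRk_atomsBelow_old (x : L) :
    famRk (atomFamily E.Carrier) (atomsBelow (.old x)) = rk x := by
  classical
  have hmem : ∀ y : L, atomsBelow (.old y) ∈ atomFamily E.Carrier := fun y => ⟨_, rfl⟩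
  refine le_antisymm ?_ (rk_le_of_strictMono_below
    (fun y : L => famRk (atomFamily E.Carrier) (atomsBelow (.old y))) x
    fun a b hab _ => famRk_lt (hmem a) (hmem b) (atomsBelow_old_ssubset hab))
  let ρ : Set E.Carrier → ℕ := fun T =>
    if h : ∃ y : L, atomsBelow (.old y) = T then rk h.choose else 1
  have hρ : ∀ y : L, ρ (atomsBelow (.old y)) = rk y := by
    intro y
    have h : ∃ z : L, atomsBelow (.old z : E.Carrier) = atomsBelow (.old y) := ⟨y, rfl⟩
    simp only [ρ, dif_pos h]
    rw [atomsBelow_old_injective h.choose_spec]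
  have hρ' : ∀ d : E.D, ρ {.new d} = 1 := by
    intro d
    have h : ¬ ∃ z : L, atomsBelow (.old z : E.Carrier) = {.new d} := by
      rintro ⟨z, hz⟩
      have hd : E.base d ≤ z := (mem_atomsBelow_old.1 (hz.superset rfl)).2
      have h2 := (E.two_le_rk_base d).trans (rk_le_rk hd)
      obtain ⟨y, hy, e⟩ := exists_lt_rk_eq (x := z) (n := 1) (by omega)
      have h3 := atomsBelow_old_ssubset (E := E) hy
      rw [hz, Set.ssubset_singleton_iff, ← E.atomsBelow_old_bot] at h3
      rw [atomsBelow_old_injective h3, rk_isBot isBot_bot] at e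
      omega
    simp only [ρ, dif_neg h]
  rw [← hρ x]
  refine famRk_le_of_strictMono_below ρ (hmem x) ?_
  rintro _ ⟨y | d, rfl⟩ _ ⟨z | e, rfl⟩ hYZ -
  · rw [hρ, hρ]
    exact rk_lt_rk (lt_of_le_not_ge (atomsBelow_old_subset_iff.1 hYZ.subset)
      fun h => hYZ.not_subset (atomsBelow_old_subset_iff.2 h))
  · rw [atomsBelow_of_mem (new_mem_atomSet e), Set.ssubset_singleton_iff,
      ← E.atomsBelow_old_bot] at hYZ
    rw [atomsBelow_of_mem (new_mem_atomSet e), hYZ, hρ, hρ', rk_isBot isBot_bot]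
    omega
  · rw [atomsBelow_of_mem (new_mem_atomSet d), hρ, hρ']
    have h := hYZ.subset (show Carrier.new d ∈ _ from ⟨new_mem_atomSet d, le_rfl⟩)
    have h2 : E.base d ≤ z := (mem_atomsBelow_old.1 h).2
    have := (E.two_le_rk_base d).trans (rk_le_rk h2)
    omega
  · rw [atomsBelow_of_mem (new_mem_atomSet d), atomsBelow_of_mem (new_mem_atomSet e),
      Set.ssubset_singleton_iff] at hYZ
    exact absurd hYZ (Set.singleton_ne_empty _)

end StandardForm

/-! ### Geometric families over a standard form bound the size of a best extension -/

section CardBound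

variable {L : Type u} [Lattice L] [OrderBot L] [Finite L] [IsUpperModularLattice L]
  {G : Type v} [Lattice G]

lemma IsBestExtension.card_le_of_geomFamily (hG : IsBestExtension L G) {E : StandardForm L}
    {Q : Set (Set E.Carrier)} {r : Set E.Carrier → ℕ} (hQ : GeomFamily (atomSet E.Carrier) Q r)
    (hS : atomFamily E.Carrier ⊆ Q) (hr : ∀ x : L, r (atomsBelow (.old x)) = rk x) :
    Nat.card G ≤ Q.ncard := by
  let := hQ.lattice
  have hmem : ∀ x : L, atomsBelow (.old x) ∈ Q := fun x => hS ⟨_, rfl⟩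
  rw [← Nat.card_coe_set_eq]
  refine hG.card_le hQ.isFiniteGeometric (coverPreservingEmbeds_of_rk
    (fun x => (⟨atomsBelow (.old x), hmem x⟩ : Q)) (fun x y => Subtype.ext ?_) ?_ fun x => ?_)
  · exact StandardForm.atomsBelow_old_inf x y
  · intro x y h
    exact StandardForm.atomsBelow_old_injective (congrArg Subtype.val h)
  · rw [← hr x, ← hQ.famRk_eq (hmem x), famRk_of_mem (hmem x)]

lemma IsBestExtension.card_le_of_memOutputClass (hG : IsBestExtension L G) {n : ℕ}
    {E : StandardForm L} {Q : Set (Set E.Carrier)} (hQ : MemOutputClass n E Q) :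
    Nat.card G ≤ Q.ncard := by
  obtain ⟨⟨m, -, hrun⟩, hM, -⟩ := hQ
  have hS := E.basicFamily_atomFamily
  have hext := rankExtension_of_run hS hrun
  refine hG.card_le_of_geomFamily (hM.geomFamily (hext.basic hS)) hext.subset fun x => ?_
  rw [hext.rank_eq _ ⟨_, rfl⟩, E.famRk_atomsBelow_old]

end CardBound

/-! ### The geometric family of elements that cover a fixed element of a semimodular lattice -/

section CoverFamily

variable {α : Type u} [Finite α] {G : Type v} [Lattice G]

lemma exists_span (o : G) (a : α → G) (X : Set α) :
    ∃ s, o ≤ s ∧ (∀ p ∈ X, a p ≤ s) ∧ ∀ z, o ≤ z → (∀ p ∈ X, a p ≤ z) → s ≤ z := by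
  induction X, X.toFinite using Set.Finite.induction_on with
  | empty => exact ⟨o, le_rfl, by simp, fun z hz _ => hz⟩
  | @insert p X hp hX ih =>
    obtain ⟨s, hs, hXs, hleast⟩ := ih
    refine ⟨s ⊔ a p, hs.trans le_sup_left, ?_, fun z hz h => ?_⟩
    · rintro q (rfl | hq)
      · exact le_sup_right
      · exact (hXs q hq).trans le_sup_left
    · exact sup_le (hleast z hz fun q hq => h q (Or.inr hq)) (h p (Or.inl rfl))

/-- The join of `o` and the elements `a p` with `p ∈ X`. -/
noncomputable def span (o : G) (a : α → G) (X : Set α) : G := (exists_span o a X).choose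

lemma le_span (o : G) (a : α → G) (X : Set α) : o ≤ span o a X :=
  (exists_span o a X).choose_spec.1

lemma apply_le_span (o : G) (a : α → G) {X : Set α} {p : α} (hp : p ∈ X) : a p ≤ span o a X :=
  (exists_span o a X).choose_spec.2.1 p hp

lemma span_le {o : G} {a : α → G} {X : Set α} {z : G} (hz : o ≤ z) (h : ∀ p ∈ X, a p ≤ z) :
    span o a X ≤ z :=
  (exists_span o a X).choose_spec.2.2 z hz h

lemma span_mono (o : G) (a : α → G) {X Y : Set α} (h : X ⊆ Y) : span o a X ≤ span o a Y :=
  span_le (le_span o a Y) fun _ hp => apply_le_span o a (h hp)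

/-- The elements of the ground set that `a` maps below `g`. -/
def flat (A : Set α) (a : α → G) (g : G) : Set α := {p | p ∈ A ∧ a p ≤ g}

omit [Finite α] in
lemma flat_inf (A : Set α) (a : α → G) (g h : G) : flat A a (g ⊓ h) = flat A a g ∩ flat A a h := by
  ext p
  simp only [flat, Set.mem_inter_iff, Set.mem_ofPred_eq, le_inf_iff]
  tauto

variable {A : Set α} {a : α → G} {o : G}

lemma flat_span (hcov : ∀ p ∈ A, o ⋖ a p) (g : G) :
    flat A a (span o a (flat A a g)) = flat A a g := by
  refine Set.Subset.antisymm ?_ fun p hp => ⟨hp.1, apply_le_span o a hp⟩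
  rintro p ⟨hp, hpg⟩
  refine ⟨hp, ?_⟩
  -- A non-empty flat forces o ≤ g, so the span stays below g. For an empty flat, where g need not
  -- lie above o, the span is o itself.
  by_cases hne : (flat A a g).Nonempty
  · obtain ⟨q, hq⟩ := hne
    exact hpg.trans (span_le ((hcov q hq.1).le.trans hq.2) fun x hx => hx.2)
  · rw [Set.not_nonempty_iff_eq_empty.1 hne] at hpg
    exact absurd (hpg.trans (span_le le_rfl (by simp))) (hcov p hp).lt.not_ge

/-- Flats correspond to their spans, which are joins of covers of o. By semimodularity, joining one
more cover a p of o to a span not above it gives a cover of that span, which is the step of rank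
one. -/
lemma geomFamily_range_flat [Finite G] [IsUpperModularLattice G] (hcov : ∀ p ∈ A, o ⋖ a p)
    (hinj : Set.InjOn a A) :
    GeomFamily A (Set.range (flat A a)) fun X => rk (span o a X) - rk o where
  sub := by
    rintro _ ⟨g, rfl⟩ p hp
    exact hp.1
  empty := ⟨o, Set.eq_empty_of_forall_notMem fun p hp => (hcov p hp.1).lt.not_ge hp.2⟩
  single p hp := by
    refine ⟨a p, Set.Subset.antisymm ?_ (Set.singleton_subset_iff.2 ⟨hp, le_rfl⟩)⟩
    rintro q ⟨hq, hqp⟩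
    exact hinj hq hp (((hcov p hp).eq_or_eq (hcov q hq).le hqp).resolve_left (hcov q hq).ne')
  rank_empty := by
    rw [(span_le le_rfl (by simp)).antisymm (le_span o a ∅)]
    exact Nat.sub_self _
  rank_lt := by
    rintro _ ⟨g, rfl⟩ _ ⟨h, rfl⟩ hgh
    have hlt : span o a (flat A a g) < span o a (flat A a h) := by
      refine (span_mono o a hgh.subset).lt_of_ne fun e => hgh.ne ?_
      rw [← flat_span hcov g, e, flat_span hcov h]
    have h1 := rk_lt_rk hlt
    have h2 := rk_le_rk (le_span o a (flat A a g))
    omega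
  step := by
    rintro _ ⟨g, rfl⟩ p hp hpX
    set X := flat A a g with hX
    have hFX : flat A a (span o a X) = X := flat_span hcov g
    have hnle : ¬ a p ≤ span o a X := fun h => hpX (hFX ▸ ⟨hp, h⟩)
    have hinf : a p ⊓ span o a X = o :=
      ((hcov p hp).eq_or_eq (le_inf (hcov p hp).le (le_span o a X)) inf_le_left).resolve_right
        fun h => hnle (inf_eq_left.1 h)
    have hc : span o a X ⋖ a p ⊔ span o a X :=
      IsUpperModularLattice.covBy_sup_of_inf_covBy (by rw [hinf]; exact hcov p hp)
    have hXC : X ⊆ flat A a (a p ⊔ span o a X) := fun q hq =>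
      ⟨hq.1, (apply_le_span o a hq).trans le_sup_right⟩
    have hpC : p ∈ flat A a (a p ⊔ span o a X) := ⟨hp, le_sup_left⟩
    have hspan : span o a (flat A a (a p ⊔ span o a X)) = a p ⊔ span o a X :=
      le_antisymm (span_le ((le_span o a X).trans le_sup_right) fun q hq => hq.2)
        (sup_le (apply_le_span o a hpC) (span_mono o a hXC))
    refine ⟨_, ⟨_, rfl⟩, hXC, hpC, ?_, ?_⟩
    · rintro _ ⟨h, rfl⟩ hXZ hpZ q hq
      rw [← flat_span hcov h]
      exact ⟨hq.1, hq.2.trans (sup_le (apply_le_span o a hpZ) (span_mono o a hXZ))⟩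
    · have h1 := rk_covBy hc
      have h2 := rk_le_rk (le_span o a X)
      simp only [hspan]
      omega

end CoverFamily

/-! ### The standard form with one inserted element for each join-irreducible non-atom -/

/-- The extending standard form in which every `Δ(x)` with `x ∈ J(L) ∩ H(L)` has exactly one
element, and the other `Δ(x)` are empty. -/
noncomputable def minimalForm (L : Type u) [Lattice L] [Finite L] : StandardForm L where
  -- The inserted set must be a type in the lowest universe, so the join-irreducible non-atoms are
  -- numbered.
  D := Fin (Nat.card ↥(joinIrr L ∩ nonAtoms L))
  finite_D := inferInstance
  base d := ((Finite.equivFin ↥(joinIrr L ∩ nonAtoms L)).symm d : L)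
  base_mem d := ((Finite.equivFin ↥(joinIrr L ∩ nonAtoms L)).symm d).2.2
  exists_base x hx := ⟨Finite.equivFin _ ⟨x, hx⟩,
    congrArg Subtype.val ((Finite.equivFin _).symm_apply_apply ⟨x, hx⟩)⟩

section MinimalForm

variable {L : Type u} [Lattice L] [Finite L] [OrderBot L]

lemma supIrred_origin {p : (minimalForm L).Carrier} (hp : p ∈ atomSet (minimalForm L).Carrier) :
    SupIrred p.origin := by
  rcases p with x | d
  · exact StandardForm.supIrred_of_mem_atomSet (StandardForm.mem_atomSet_of_old hp)
  · exact ((Finite.equivFin ↥(joinIrr L ∩ nonAtoms L)).symm d).2.1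

lemma origin_injOn : Set.InjOn (StandardForm.Carrier.origin (E := minimalForm L))
    (atomSet (minimalForm L).Carrier) := by
  rintro (x | d) hp (y | e) hq h
  · exact congrArg _ h
  · exact absurd (StandardForm.mem_atomSet_of_old hp)
      (by rw [show x = (minimalForm L).base e from h]; exact ((minimalForm L).base_mem e).1)
  · exact absurd (StandardForm.mem_atomSet_of_old hq)
      (by rw [← show (minimalForm L).base d = y from h]; exact ((minimalForm L).base_mem d).1)
  · exact congrArg _ ((Finite.equivFin ↥(joinIrr L ∩ nonAtoms L)).symm.injective (Subtype.ext h))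

lemma ncard_atomSet_minimalForm :
    (atomSet (minimalForm L).Carrier).ncard = (joinIrr L).ncard := by
  rw [← origin_injOn.ncard_image]
  congr 1
  ext j
  constructor
  · rintro ⟨p, hp, rfl⟩
    exact supIrred_origin hp
  · intro hj
    exact StandardForm.exists_origin_eq hj

end MinimalForm

/-! ### Extensions of a semimodular lattice -/

section Extension

variable {L : Type u} [Lattice L] [Finite L] {G : Type v} [Lattice G]

lemma SupIrred.exists_covBy_forall_lt {j : L} (hj : SupIrred j) :
    ∃ t, t ⋖ j ∧ ∀ y < j, y ≤ t := by
  obtain ⟨t, ht, -⟩ := exists_covBy_rk (x := j) fun h => hj.1 (isMin_of_rk_eq_zero h)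
  refine ⟨t, ht, fun y hy => ?_⟩
  rcases ht.eq_or_eq (le_sup_right : t ≤ y ⊔ t) (sup_le hy.le ht.le) with h | h
  · exact sup_eq_right.1 h
  · rcases hj.2 h with h | h
    · exact absurd h hy.ne
    · exact absurd h ht.ne

/-- Some atom c of G lies below f j but not below f t, where t is the only lower cover of j. As f
need not preserve the least element, c is joined with f ⊥. -/
lemma exists_cover_of_supIrred [OrderBot L] (hG : IsFiniteGeometric G) (f : LatticeHom L G)
    (hf : Function.Injective f) {j : L} (hj : SupIrred j) :
    ∃ a, f ⊥ ⋖ a ∧ a ≤ f j ∧ ∀ y < j, ¬ a ≤ f y := by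
  obtain ⟨hfin, hmod, hat⟩ := hG
  have hmono : Monotone f := OrderHomClass.mono f
  obtain ⟨t, ht, htmax⟩ := hj.exists_covBy_forall_lt
  obtain ⟨s, hs, hlub⟩ := hat (f j)
  obtain ⟨c, hc, hct⟩ : ∃ c ∈ s, ¬ c ≤ f t := by
    by_contra! h
    exact ht.ne (hf (le_antisymm (hmono ht.le) (hlub.2 h)))
  obtain ⟨b, hb, hbc⟩ := hs hc
  have hinf : c ⊓ f ⊥ = b := (hbc.eq_or_eq (hb _) inf_le_left).resolve_right fun h =>
    hct ((inf_eq_left.1 h).trans (hmono bot_le))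
  refine ⟨c ⊔ f ⊥, IsUpperModularLattice.covBy_sup_of_inf_covBy (by rw [hinf]; exact hbc),
    sup_le (hlub.1 hc) (hmono bot_le), fun y hy h => hct ?_⟩
  exact (le_sup_left.trans h).trans (hmono (htmax y hy))

lemma rk_map [OrderBot L] [IsUpperModularLattice L] [Finite G] [IsUpperModularLattice G]
    (f : LatticeHom L G) (hcov : ∀ a b : L, a ⋖ b → f a ⋖ f b) (x : L) :
    rk (f x) = rk x + rk (f ⊥) := by
  induction x using (wellFounded_lt (α := L)).induction with
  | _ x ih =>
    by_cases h0 : rk x = 0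
    · rw [(isMin_of_rk_eq_zero h0).eq_bot, rk_isBot isBot_bot, zero_add]
    · obtain ⟨y, hy, e⟩ := exists_covBy_rk h0
      rw [rk_covBy (hcov y x hy), ih y hy.lt, e]
      omega

/-- f x is generated by f ⊥ and the β j with j ≤ x: for join-irreducible j with lower cover t, the
covering f t ⋖ f j forces f t ⊔ β j = f j. -/
lemma map_le_of_forall_supIrred [OrderBot L] (f : LatticeHom L G)
    (hcov : ∀ a b : L, a ⋖ b → f a ⋖ f b) {β : L → G}
    (hβ : ∀ j, SupIrred j → β j ≤ f j ∧ ∀ y < j, ¬ β j ≤ f y) {x : L} {s : G} (hs : f ⊥ ≤ s)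
    (h : ∀ j, SupIrred j → j ≤ x → β j ≤ s) : f x ≤ s := by
  induction x using (wellFounded_lt (α := L)).induction with
  | _ x ih =>
    by_cases hx : SupIrred x
    · obtain ⟨t, ht, -⟩ := hx.exists_covBy_forall_lt
      have h1 := ih t ht.lt fun j hj hjt => h j hj (hjt.trans ht.le)
      have h2 := hβ x hx
      rcases (hcov t x ht).eq_or_eq (c := f t ⊔ β x) le_sup_left
        (sup_le (hcov t x ht).le h2.1) with h3 | h3
      · exact absurd (sup_eq_left.1 h3) (h2.2 t ht.lt)
      · rw [← h3]
        exact sup_le h1 (h x hx le_rfl)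
    · rcases not_supIrred.1 hx with hx | ⟨b, c, rfl, hb, hc⟩
      · rwa [hx.eq_bot]
      · rw [map_sup]
        exact sup_le (ih b hb fun j hj hjb => h j hj (hjb.trans hb.le))
          (ih c hc fun j hj hjc => h j hj (hjc.trans hc.le))

end Extension

/-! ### Realising a best extension as an output of the algorithm -/

lemma GeomFamily.rank_singleton {α : Type u} {A : Set α} {Q : Set (Set α)} {r : Set α → ℕ}
    (hQ : GeomFamily A Q r) {p : α} (hp : p ∈ A) : r {p} = 1 := by
  obtain ⟨C, hC, -, hpC, hleast, e⟩ := hQ.step ∅ hQ.empty p hp (Set.notMem_empty p)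
  have : C = {p} := Set.Subset.antisymm (hleast {p} (hQ.single p hp) (Set.empty_subset _) rfl)
    (Set.singleton_subset_iff.2 hpC)
  rw [← this, e, hQ.rank_empty]

lemma BasicFamily.ncard_atomSet {α : Type u} {A : Set α} {R : Set (Set α)}
    (hR : BasicFamily A R) : (atomSet R).ncard = A.ncard := by
  rw [← Set.ncard_image_of_injective (atomSet R) Subtype.val_injective,
    ← Set.ncard_image_of_injective A Set.singleton_injective]
  congr 1
  ext T
  constructor
  · rintro ⟨T, hT, rfl⟩
    obtain ⟨a, ha, hTa⟩ := (hR.mem_atomSet_iff T).1 hT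
    exact ⟨a, ha, hTa.symm⟩
  · rintro ⟨a, ha, rfl⟩
    exact ⟨⟨{a}, hR.single a ha⟩, (hR.mem_atomSet_iff _).2 ⟨a, ha, rfl⟩, rfl⟩

lemma GeomFamily.famRk_atomFamily {L : Type u} [Lattice L] [Finite L] [OrderBot L]
    {E : StandardForm L} {Q : Set (Set E.Carrier)} {r : Set E.Carrier → ℕ}
    (hQ : GeomFamily (atomSet E.Carrier) Q r) (hr : ∀ x : L, r (atomsBelow (.old x)) = rk x)
    {X : Set E.Carrier} (hX : X ∈ atomFamily E.Carrier) : famRk (atomFamily E.Carrier) X = r X := by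
  obtain ⟨x | d, rfl⟩ := hX
  · rw [E.famRk_atomsBelow_old, hr]
  · have hd := StandardForm.new_mem_atomSet (E := E) d
    have hS := E.basicFamily_atomFamily
    rw [StandardForm.atomsBelow_of_mem hd, hQ.rank_singleton hd]
    refine le_antisymm ?_ ?_
    · refine famRk_le_of_strictMono_below (fun Y => Y.ncard) (hS.single _ hd) (fun Y _ Z _ h _ =>
        Set.ncard_lt_ncard h (Set.toFinite Z)) |>.trans (Set.ncard_singleton _).le
    · exact Nat.one_le_iff_ne_zero.2 (Nat.ne_zero_of_lt (famRk_lt hS.empty (hS.single _ hd)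
        (Set.empty_ssubset.2 (Set.singleton_nonempty _))))

lemma krullDim_eq_rk_top {P : Type u} [PartialOrder P] [OrderTop P] [Finite P] :
    Order.krullDim P = (rk (⊤ : P) : WithBot ℕ∞) := by
  rw [← Order.height_top_eq_krullDim, height_eq_rk]
  rfl

lemma StandardForm.atomsBelow_old_top {L : Type u} [Lattice L] [OrderTop L] (E : StandardForm L) :
    atomsBelow (.old ⊤ : E.Carrier) = atomSet E.Carrier := by
  ext p
  rw [mem_atomsBelow_old]
  exact and_iff_left le_top

lemma GeomFamily.isAlgOutput {L : Type u} [Lattice L] [Finite L] [BoundedOrder L]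
    {E : StandardForm L} {Q : Set (Set E.Carrier)} {r : Set E.Carrier → ℕ}
    (hQ : GeomFamily (atomSet E.Carrier) Q r) (hS : atomFamily E.Carrier ⊆ Q)
    (hr : ∀ x : L, r (atomsBelow (.old x)) = rk x) : IsAlgOutput E Q := by
  refine ⟨rk (⊤ : L), krullDim_eq_rk_top, ?_⟩
  have := hQ.exists_run E.basicFamily_atomFamily hS ⟨_, E.atomsBelow_old_top⟩ fun X hX =>
    hQ.famRk_atomFamily hr hX
  rwa [← E.atomsBelow_old_top, hr] at this

lemma GeomFamily.krullDim_eq {α : Type u} [Finite α] {A : Set α} {Q : Set (Set α)}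
    {r : Set α → ℕ} (hQ : GeomFamily A Q r) : Order.krullDim Q = (r A : WithBot ℕ∞) := by
  let _ : OrderTop Q :=
    { top := ⟨A, hQ.ground_mem⟩
      le_top := fun X => hQ.sub X X.2 }
  have h : rk (⊤ : Q) = r A := by
    rw [← famRk_coe]
    exact hQ.famRk_eq hQ.ground_mem
  rw [krullDim_eq_rk_top, h]

/-- A best extension is isomorphic to a geometric family over the minimal standard form. -/
lemma IsBestExtension.exists_geomFamily {L : Type u} [Lattice L] [Finite L] [BoundedOrder L]
    [IsUpperModularLattice L] {G : Type v} [Lattice G] (hG : IsBestExtension L G) :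
    ∃ (Q : Set (Set (minimalForm L).Carrier)) (r : Set (minimalForm L).Carrier → ℕ),
      GeomFamily (atomSet (minimalForm L).Carrier) Q r ∧ atomFamily (minimalForm L).Carrier ⊆ Q ∧
      (∀ x : L, r (atomsBelow (.old x)) = rk x) ∧ Nonempty (G ≃o Q) := by
  obtain ⟨⟨hgeom, f, hf, hcov⟩, -⟩ := id hG
  have hmono : Monotone f := OrderHomClass.mono f
  have := hgeom.1
  have := hgeom.2.1
  have : Nonempty G := ⟨f ⊥⟩
  choose! β hβ using fun j : L => exists_cover_of_supIrred hgeom f hf (j := j)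
  -- If β j ≤ f x, then β j ≤ f (j ⊓ x), because f preserves meets; the choice of β j then excludes
  -- j ⊓ x < j.
  have hβle : ∀ j x, SupIrred j → (β j ≤ f x ↔ j ≤ x) := by
    refine fun j x hj => ⟨fun h => ?_, fun h => (hβ j hj).2.1.trans (hmono h)⟩
    by_contra hjx
    refine (hβ j hj).2.2 (j ⊓ x) (inf_le_left.lt_of_ne fun e => hjx (inf_eq_left.1 e)) ?_
    rw [map_inf]
    exact le_inf (hβ j hj).2.1 h
  let A := atomSet (minimalForm L).Carrier
  let a : (minimalForm L).Carrier → G := fun p => β p.origin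
  have hacov : ∀ p ∈ A, f ⊥ ⋖ a p := fun p hp => (hβ _ (supIrred_origin hp)).1
  have hainj : Set.InjOn a A := by
    intro p hp q hq (h : β p.origin = β q.origin)
    have hp' := supIrred_origin hp
    have hq' := supIrred_origin hq
    refine origin_injOn hp hq (le_antisymm ?_ ?_)
    · exact (hβle _ _ hp').1 (h ▸ (hβ _ hq').2.1)
    · exact (hβle _ _ hq').1 (h ▸ (hβ _ hp').2.1)
  have hflat : ∀ x : L, flat A a (f x) = atomsBelow (.old x) := by
    intro x
    ext p
    rw [StandardForm.mem_atomsBelow_old]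
    exact and_congr_right fun hp => hβle _ _ (supIrred_origin hp)
  have hspan : ∀ x : L, span (f ⊥) a (atomsBelow (.old x)) = f x := by
    intro x
    rw [← hflat]
    refine le_antisymm (span_le (hmono bot_le) fun p hp => hp.2) ?_
    refine map_le_of_forall_supIrred f hcov (fun j hj => (hβ j hj).2) (le_span _ _ _) ?_
    intro j hj hjx
    obtain ⟨p, hp, rfl⟩ := StandardForm.exists_origin_eq (E := minimalForm L) hj
    exact apply_le_span (f ⊥) a (p := p) ⟨hp, (hβle _ _ hj).2 hjx⟩
  have hQ := geomFamily_range_flat hacov hainj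
  have hS : atomFamily (minimalForm L).Carrier ⊆ Set.range (flat A a) := by
    rintro _ ⟨x | d, rfl⟩
    · exact ⟨f x, hflat x⟩
    · have hd := StandardForm.new_mem_atomSet (E := minimalForm L) d
      rw [StandardForm.atomsBelow_of_mem hd]
      exact hQ.single _ hd
  have hr : ∀ x : L, rk (span (f ⊥) a (atomsBelow (.old x))) - rk (f ⊥) = rk x := by
    intro x
    rw [hspan, rk_map f hcov]
    omega
  refine ⟨_, _, hQ, hS, hr, ?_⟩
  -- Minimality of G enters here: the family of flats is itself an extension of L, so it cannot be a
  -- proper quotient of G and g ↦ `flat A a g` is injective.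
  have hcard := hG.card_le_of_geomFamily hQ hS hr
  rw [← Nat.card_coe_set_eq] at hcard
  have hbij : Function.Bijective (Set.rangeFactorization (flat A a)) :=
    Set.rangeFactorization_surjective.bijective_of_nat_card_le hcard
  refine ⟨{ toEquiv := Equiv.ofBijective _ hbij, map_rel_iff' := fun {g h} => ?_ }⟩
  constructor
  · intro (hgh : flat A a g ⊆ flat A a h)
    refine inf_eq_left.1 (hbij.1 (Subtype.ext ?_))
    change flat A a (g ⊓ h) = flat A a g
    rw [flat_inf, Set.inter_eq_left.2 hgh]
  · intro hgh p hp
    exact ⟨hp.1, hp.2.trans hgh⟩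

theorem mainTheorem1 {L : Type u} [Lattice L] [Finite L] [Nonempty L] [IsUpperModularLattice L]
    {G : Type v} [Lattice G] (hG : IsBestExtension L G) :
    (∃ (E : StandardForm L) (Q : Set (Set E.Carrier)),
      MemOutputClass (joinIrr L).ncard E Q ∧
      (∀ (E' : StandardForm L) (Q' : Set (Set E'.Carrier)),
        MemOutputClass (joinIrr L).ncard E' Q' → Q.ncard ≤ Q'.ncard) ∧
      Nonempty (G ≃o Q)) ∧
    Order.krullDim G = Order.krullDim L ∧
    (atomSet G).ncard = (joinIrr L).ncard := by
  have := Fintype.ofFinite L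
  let _ : BoundedOrder L := Fintype.toBoundedOrder L
  obtain ⟨Q, r, hQ, hS, hr, ⟨e⟩⟩ := IsBestExtension.exists_geomFamily hG
  have hatoms : (atomSet Q).ncard = (joinIrr L).ncard := by
    rw [hQ.ncard_atomSet, ncard_atomSet_minimalForm]
  have hout := hQ.isAlgOutput hS hr
  refine ⟨⟨minimalForm L, Q, ⟨hout, hQ.conditionM, hatoms⟩, fun E' Q' h => ?_, ⟨e⟩⟩, ?_, ?_⟩
  · rw [← Nat.card_coe_set_eq, ← Nat.card_congr e.toEquiv]
    exact hG.card_le_of_memOutputClass h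
  · rw [Order.krullDim_eq_of_orderIso e, hQ.krullDim_eq, ← (minimalForm L).atomsBelow_old_top, hr,
      krullDim_eq_rk_top]
  · rw [← hatoms, ← atomSet_image e, Set.ncard_image_of_injective _ e.injective]
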